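/- Notation. Let $q\in\mathbb{C}$, $0<|q|<1$, fix a value $q^{1/2}$ of the square root of $q$, and put $(x;q)_n=\prod_{k=0}^{n-1}(1-xq^k)$, $(x;q)_\infty=\prod_{k\ge 0}(1-xq^k)$, $(x_1,\dots,x_r;q)_\infty=\prod_i (x_i;q)_\infty$. The very-well-poised series is $${}_{8}W_{7}(A;b_1,\dots,b_5;q,z)=\sum_{n\ge 0}\frac{(A,qA^{1/2},-qA^{1/2},b_1,\dots,b_5;q)_n}{(q,A^{1/2},-A^{1/2},qA/b_1,\dots,qA/b_5;q)_n}\,z^n .$$ Let $a_1,\dots,a_4\in\mathbb{C}\setminus\{0\}$, let $\sigma_k$ be the $k$-th elementary symmetric polynomial in $a_1,\dots,a_4$, let $\alpha\in\mathbb{C}$, and put $w_0(z)=\prod_{j=1}^4(1-q^{-1/2}a_jz)$. Consider, for an unknown function $m$ of $t\in\mathbb{C}\setminus\{0\}$, the three-term recurrence $$\begin{aligned} &(q^{-1/2}t-q^{1/2}t^{-1})\,w_0(q^{-1/2}\alpha t^{-1})\,m(qt)\\ &-q^{-1/2}(t-t^{-1})\Big[(1+q)(1+q^{-1}\alpha^2\sigma_2+q^{-2}\alpha^4\sigma_4)+q^{-1}\alpha^2(q+\sigma_4)(q^{1/2}t-q^{-1/2}t^{-1})(q^{-1/2}t-q^{1/2}t^{-1})\\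 &\qquad\qquad-\alpha(t+t^{-1})(\sigma_1+q^{-1}\alpha^2\sigma_3)\Big]m(t)\\ &+(q^{1/2}t-q^{-1/2}t^{-1})\,w_0(q^{-1/2}\alpha t)\,m(q^{-1}t)=0. \end{aligned}\tag{R}$$ Choose for each $t\ne 0$ a square root $t^{1/2}$ so that $(qt)^{1/2}=q^{1/2}t^{1/2}$, and put $$\begin{aligned} M(t)={}&t^{1/2}(q\alpha t,\alpha^{-1}t^{-1},q^{1/2}\alpha t,q^{1/2}\alpha^{-1}t^{-1};q)_\infty\; \frac{(a_1^{-1}\sigma_4\alpha t,a_2^{-1}\sigma_4\alpha t,a_3^{-1}\sigma_4\alpha t,a_4^{-1}\sigma_4\alpha t;q)_\infty}{(a_1\alpha t,a_2\alpha t,a_3\alpha t,a_4\alpha t,t^{-2},\sigma_4\alpha^2t^2;q)_\infty}\\ &\times{}_{8}W_{7}(q^{-1}\sigma_4\alpha^2t^2;\,q^{-1}\sigma_4\alpha^2,a_1\alpha t,a_2\alpha t,a_3\alpha t,a_4\alpha t;\,q,\,q\alpha^{-2}). \end{aligned}$$ Call $t\neq 0$ nondegenerate if no denominator in $M(t)$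 vanishes, i.e. none of $t^{-2}$, $qt^2$, $q^{-1}\sigma_4\alpha^2t^2$, $a_j\alpha t$, $a_j^{-1}\sigma_4\alpha t$ $(1\le j\le 4)$ lies in $q^{-\mathbb{Z}_{\ge 0}}$. **Proposition.** Assume $|\alpha^2|>|q|$ and $q^{-1}\sigma_4\alpha^2\notin q^{-\mathbb{Z}_{\ge 0}}$. 1. $M(t)$ satisfies (R) at every $t$ such that $qt,t,q^{-1}t$ are nondegenerate, and $t\mapsto M(t^{-1})$ satisfies (R) at every $t$ such that $(qt)^{-1},t^{-1},(q^{-1}t)^{-1}$ are nondegenerate. 2. Assume moreover that $a_ia_j\notin q^{-\mathbb{Z}_{\ge 0}}$ for $i\neq j$. Then the two solutions are independent: if $\alpha t,\,q^{1/2}\alpha t,\,\alpha t^{-1},\,q^{1/2}\alpha t^{-1}\notin q^{\mathbb{Z}}$ and $t,t^{-1},qt,(qt)^{-1}$ are nondegenerate, then $$M(t)M\big((qt)^{-1}\big)-M(qt)M(t^{-1})\neq 0 .$$ Furthermore, if $\alpha t,\,q^{1/2}\alpha t,\,\alpha t^{-1},\,q^{1/2}\alpha t^{-1}\notin q^{\mathbb{Z}}$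 and $q^nt$ and $(q^nt)^{-1}$ are nondegenerate for all $n\in\mathbb{Z}$, then every $m$ which satisfies (R) at all points $q^nt$, $n\in\mathbb{Z}$, is of the form $m(q^nt)=c_1M(q^nt)+c_2M((q^nt)^{-1})$ $(n\in\mathbb{Z})$ with unique constants $c_1,c_2\in\mathbb{C}$. -/

import Mathlib

noncomputable section

namespace QMoment

/-- The finite `q`-Pochhammer symbol `(a;q)_n`. -/
def qPoch (q a : ℂ) (n : ℕ) : ℂ := ∏ k ∈ Finset.range n, (1 - a * q ^ k)

/-- The infinite `q`-Pochhammer symbol `(a;q)_∞` (used for `‖q‖ < 1`). -/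
def qPochInf (q a : ℂ) : ℂ := ∏' k : ℕ, (1 - a * q ^ k)

/-- The basic hypergeometric series `_{r+1}φ_r` with the list `as` of `r + 1` upper parameters
and the list `bs` of `r` lower parameters. -/
def basicHyp (as bs : List ℂ) (q z : ℂ) : ℂ :=
  ∑' n : ℕ, (as.map fun a => qPoch q a n).prod /
    (qPoch q q n * (bs.map fun b => qPoch q b n).prod) * z ^ n

/-- The very-well-poised series `_{r+1}W_r(a₁; a₄, …, a_{r+1}; q, z)`, where `as` is the list
`a₄, …, a_{r+1}`. The value does not depend on which square root of `a₁` is used. -/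
def veryWellPoised (a₁ : ℂ) (as : List ℂ) (q z : ℂ) : ℂ :=
  basicHyp (a₁ :: (q * a₁ ^ (1 / 2 : ℂ)) :: (-(q * a₁ ^ (1 / 2 : ℂ))) :: as)
    (a₁ ^ (1 / 2 : ℂ) :: (-(a₁ ^ (1 / 2 : ℂ))) :: as.map fun c => q * a₁ / c) q z

/-- The `k`-th elementary symmetric polynomial `σ_k` of `a₁, …, a₄`. -/
def sigma (a : Fin 4 → ℂ) (k : ℕ) : ℂ :=
  ∑ s ∈ Finset.powersetCard k (Finset.univ : Finset (Fin 4)), ∏ j ∈ s, a j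

/-- `w₀(z) = ∏_j (1 - q^{-1/2} a_j z)`; here `qh` is the chosen value of `q^{1/2}`. -/
def w0 (qh : ℂ) (a : Fin 4 → ℂ) (z : ℂ) : ℂ := ∏ j, (1 - qh⁻¹ * a j * z)

/-- The three-term recurrence in the deformation variable at the point `t`, for an unknown
function `m`; here `qh` is the chosen value of `q^{1/2}`. -/
def ThreeTermAt (q qh α : ℂ) (a : Fin 4 → ℂ) (m : ℂ → ℂ) (t : ℂ) : Prop :=
  (qh⁻¹ * t - qh * t⁻¹) * w0 qh a (qh⁻¹ * α * t⁻¹) * m (q * t)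
    - qh⁻¹ * (t - t⁻¹) *
      ((1 + q) * (1 + q⁻¹ * α ^ 2 * sigma a 2 + q⁻¹ ^ 2 * α ^ 4 * sigma a 4)
        + q⁻¹ * α ^ 2 * (q + sigma a 4) * (qh * t - qh⁻¹ * t⁻¹) * (qh⁻¹ * t - qh * t⁻¹)
        - α * (t + t⁻¹) * (sigma a 1 + q⁻¹ * α ^ 2 * sigma a 3)) * m t
    + (qh * t - qh⁻¹ * t⁻¹) * w0 qh a (qh⁻¹ * α * t) * m (q⁻¹ * t) = 0

/-- The explicit function built from infinite products and an `₈W₇`; `rt` is the chosen branch of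
`t ↦ t^{1/2}` and `qh` the chosen value of `q^{1/2}`. -/
def solution (q qh α : ℂ) (a : Fin 4 → ℂ) (rt : ℂ → ℂ) (t : ℂ) : ℂ :=
  rt t * (qPochInf q (q * α * t) * qPochInf q (α⁻¹ * t⁻¹) *
      qPochInf q (qh * α * t) * qPochInf q (qh * α⁻¹ * t⁻¹))
    * ((∏ j, qPochInf q ((a j)⁻¹ * sigma a 4 * α * t)) /
      ((∏ j, qPochInf q (a j * α * t)) * qPochInf q (t⁻¹ ^ 2) *
        qPochInf q (sigma a 4 * α ^ 2 * t ^ 2)))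
    * veryWellPoised (q⁻¹ * sigma a 4 * α ^ 2 * t ^ 2)
        [q⁻¹ * sigma a 4 * α ^ 2, a 0 * α * t, a 1 * α * t, a 2 * α * t, a 3 * α * t]
        q (q * (α ^ 2)⁻¹)

/-- The set `q^{-ℤ_{≥0}}`. -/
def qNeg (q : ℂ) : Set ℂ := {x | ∃ n : ℕ, x = (q ^ n)⁻¹}

/-- The set `q^ℤ`. -/
def qAll (q : ℂ) : Set ℂ := {x | ∃ n : ℤ, x = q ^ n}

/-- Nondegeneracy at `t`: no denominator in the expression `solution` vanishes at `t`.
The condition on `q⁻¹σ₄α²t²` covers the lower parameters `±√a₁` and the factor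
`(σ₄α²t²;q)_∞`; `q t²` and `a_j⁻¹σ₄αt` are the other lower parameters of the series. -/
structure Nondegenerate (q α : ℂ) (a : Fin 4 → ℂ) (t : ℂ) : Prop where
  ne_zero : t ≠ 0
  inv_sq : t⁻¹ ^ 2 ∉ qNeg q
  mul_sq : q * t ^ 2 ∉ qNeg q
  base : q⁻¹ * sigma a 4 * α ^ 2 * t ^ 2 ∉ qNeg q
  upper : ∀ j, a j * α * t ∉ qNeg q
  lower : ∀ j, (a j)⁻¹ * sigma a 4 * α * t ∉ qNeg q

/-- The theta-function prefactors of `solution` at `t` and at `t⁻¹` do not vanish. -/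
def PrefactorNeZero (q qh α t : ℂ) : Prop :=
  α * t ∉ qAll q ∧ qh * α * t ∉ qAll q ∧ α * t⁻¹ ∉ qAll q ∧ qh * α * t⁻¹ ∉ qAll q

end QMoment

end

open Filter Topology

namespace QMoment

/-! With `w = α⁻²` and the rescaled parameters `a, b, c, d = a_j α`, write M as an explicit
prefactor times a normalized ₈W₇, divided by `(at, bt, ct, dt; q)_∞` (`solution_eq`). The prefactor
has a rational ratio under `t ↦ qt` (`prefactor_mul`), so (R) becomes a three-term relation for the
normalized series `nSum` (`nSum_recurrence`). That relation is proved by creative telescoping: the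
m-th term at `qt`, the (m+1)-st at `t` and the (m+2)-nd at `q⁻¹t`, with the right coefficients, add
up to a difference of an explicit antidifference `nCert`. After division by a common factor this is
a rational identity in `q^m` (`telescope_identity`). Since (R) is invariant under `t ↦ t⁻¹`, the
second solution comes for free.

For independence, the normalized Casoratian `nCas` of the series at `t` and `t⁻¹` is invariant under
`t ↦ q⁻¹t` (`nCas_step`). If `at = 1` it can be computed: one of its two products vanishes, and in
the other one series stops at its first term while the second collapses to a ₆W₅, which has a
product evaluation (`sixSum_eval`). By the shift invariance the same value is found at all `a = q^m
t⁻¹`. These points accumulate at 0, and after clearing denominators both sides are entire in `a`, so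
the identity theorem gives the value for every `a` (`uCas_generic`); exceptional values of `b` are
removed by density and continuity (`uCas_eval`). The Casoratian of M is thus an explicit product,
whose zeros are excluded by the hypotheses.

Along a q-orbit, (R) is a second-order recurrence with nonvanishing outer coefficients, so two
solutions with nonzero Casoratian form a basis (`existsUnique_of_recurrence`). -/

/-! ### Finite and infinite q-Pochhammer symbols. -/

lemma qPoch_zero (q a : ℂ) : qPoch q a 0 = 1 := by simp [qPoch]

lemma qPoch_succ (q a : ℂ) (n : ℕ) : qPoch q a (n + 1) = qPoch q a n * (1 - a * q ^ n) := by
  simp [qPoch, Finset.prod_range_succ]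

lemma qPoch_succ' (q a : ℂ) (n : ℕ) : qPoch q a (n + 1) = (1 - a) * qPoch q (a * q) n := by
  simp only [qPoch, Finset.prod_range_succ', pow_zero, mul_one]
  rw [mul_comm]
  congr 1
  exact Finset.prod_congr rfl fun k _ => by ring

lemma qPoch_ne_zero {q a : ℂ} (ha : a ∉ qNeg q) (n : ℕ) : qPoch q a n ≠ 0 := by
  refine Finset.prod_ne_zero_iff.mpr fun k _ h => ha ⟨k, ?_⟩
  exact eq_inv_of_mul_eq_one_left (by linear_combination -h)

lemma qPoch_self_ne_zero {q : ℂ} (hq1 : ‖q‖ < 1) (n : ℕ) : qPoch q q n ≠ 0 := by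
  refine Finset.prod_ne_zero_iff.mpr fun k _ h => ?_
  have h1 : q ^ (k + 1) = 1 := by linear_combination -h
  have h2 : ‖q‖ ^ (k + 1) < 1 := pow_lt_one₀ (norm_nonneg _) hq1 (by omega)
  rw [← norm_pow, h1] at h2
  simp at h2

lemma summable_norm_mul_pow {q : ℂ} (hq1 : ‖q‖ < 1) (a : ℂ) :
    Summable fun k : ℕ => ‖-(a * q ^ k)‖ := by
  simpa using (summable_geometric_of_lt_one (norm_nonneg q) hq1).mul_left ‖a‖

lemma multipliable_one_sub_mul_pow {q : ℂ} (hq1 : ‖q‖ < 1) (a : ℂ) :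
    Multipliable fun k : ℕ => 1 - a * q ^ k := by
  simpa [sub_eq_add_neg] using multipliable_one_add_of_summable (summable_norm_mul_pow hq1 a)

lemma qPochInf_eq {q : ℂ} (hq1 : ‖q‖ < 1) (a : ℂ) (n : ℕ) :
    qPochInf q a = qPoch q a n * qPochInf q (a * q ^ n) := by
  have h : Multipliable fun k : ℕ => 1 - a * q ^ (k + n) := by
    convert multipliable_one_sub_mul_pow hq1 (a * q ^ n) using 2 with k
    ring
  have h2 := Multipliable.prod_mul_tprod_nat_mul' (f := fun k : ℕ => 1 - a * q ^ k) h
  unfold qPochInf qPoch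
  rw [← h2]
  congr 1
  exact tprod_congr fun k => by ring

lemma qPochInf_eq_mul {q : ℂ} (hq1 : ‖q‖ < 1) (a : ℂ) :
    qPochInf q a = (1 - a) * qPochInf q (a * q) := by
  simpa [qPoch] using qPochInf_eq hq1 a 1

lemma qPochInf_zero (q : ℂ) : qPochInf q 0 = 1 := by simp [qPochInf]

lemma qPochInf_ne_zero {q a : ℂ} (hq1 : ‖q‖ < 1) (ha : a ∉ qNeg q) :
    qPochInf q a ≠ 0 := by
  have := tprod_one_add_ne_zero_of_summable (f := fun k : ℕ => -(a * q ^ k)) (fun k h => ha ⟨k, ?_⟩)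
    (summable_norm_mul_pow hq1 a)
  · simpa [qPochInf, sub_eq_add_neg] using this
  · exact eq_inv_of_mul_eq_one_left (by linear_combination -h)

lemma tendsto_qPoch {q : ℂ} (hq1 : ‖q‖ < 1) (a : ℂ) :
    Tendsto (qPoch q a) atTop (𝓝 (qPochInf q a)) :=
  (multipliable_one_sub_mul_pow hq1 a).hasProd.tendsto_prod_nat

lemma differentiable_qPoch (q : ℂ) (n : ℕ) : Differentiable ℂ fun a => qPoch q a n := by
  unfold qPoch
  fun_prop

/-- On a disc of radius `‖x‖ + 1` the factors differ from 1 by at most a geometric sequence, so the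
product converges locally uniformly. Being entire is what later permits the identity theorem in a
parameter. -/
lemma differentiable_qPochInf {q : ℂ} (hq1 : ‖q‖ < 1) : Differentiable ℂ (qPochInf q) := by
  intro x
  have h : HasProdLocallyUniformlyOn (fun (k : ℕ) (a : ℂ) => 1 + -(a * q ^ k))
      (fun a => ∏' k : ℕ, (1 + -(a * q ^ k))) (Metric.ball (0 : ℂ) (‖x‖ + 1)) := by
    refine Summable.hasProdLocallyUniformlyOn_nat_one_add Metric.isOpen_ball
      (u := fun k => (‖x‖ + 1) * ‖q‖ ^ k)
      ((summable_geometric_of_lt_one (norm_nonneg q) hq1).mul_left _) ?_ ?_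
    · refine Eventually.of_forall fun n y hy => ?_
      have : ‖y‖ < ‖x‖ + 1 := by simpa using hy
      rw [norm_neg, norm_mul, norm_pow]
      gcongr
    · intro n
      fun_prop
  have hd := TendstoLocallyUniformlyOn.differentiableOn h (Eventually.of_forall fun s => by
    have : Differentiable ℂ (fun a : ℂ => ∏ k ∈ s, (1 + -(a * q ^ k))) := by fun_prop
    exact this.differentiableOn) Metric.isOpen_ball
  have := hd.differentiableAt (Metric.isOpen_ball.mem_nhds (show x ∈ _ by simp))
  have he : qPochInf q = fun a => ∏' k : ℕ, (1 + -(a * q ^ k)) := by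
    funext a
    simp [qPochInf, sub_eq_add_neg]
  rw [he]
  exact this

/-- Each factor is at most `exp(‖a‖‖q‖^k)`, and the exponents form a geometric series. The bound
does not involve `n`, which gives uniform control of all series coefficients below. -/
lemma norm_qPoch_le {q : ℂ} (hq1 : ‖q‖ < 1) (a : ℂ) (n : ℕ) :
    ‖qPoch q a n‖ ≤ Real.exp (‖a‖ * (1 - ‖q‖)⁻¹) := by
  rw [qPoch, norm_prod]
  calc ∏ k ∈ Finset.range n, ‖1 - a * q ^ k‖
      ≤ ∏ k ∈ Finset.range n, Real.exp (‖a‖ * ‖q‖ ^ k) := by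
        refine Finset.prod_le_prod (fun _ _ => norm_nonneg _) fun k _ => ?_
        calc ‖1 - a * q ^ k‖ ≤ ‖(1 : ℂ)‖ + ‖a * q ^ k‖ := norm_sub_le _ _
          _ = ‖a‖ * ‖q‖ ^ k + 1 := by simp [add_comm]
          _ ≤ _ := Real.add_one_le_exp _
    _ = Real.exp (‖a‖ * ∑ k ∈ Finset.range n, ‖q‖ ^ k) := by
        rw [← Real.exp_sum, Finset.mul_sum]
    _ ≤ _ := by
        gcongr
        rw [← tsum_geometric_of_lt_one (norm_nonneg q) hq1]
        exact (summable_geometric_of_lt_one (norm_nonneg q) hq1).sum_le_tsum _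
          fun _ _ => by positivity

lemma norm_qPochInf_le {q : ℂ} (hq1 : ‖q‖ < 1) (a : ℂ) :
    ‖qPochInf q a‖ ≤ Real.exp (‖a‖ * (1 - ‖q‖)⁻¹) :=
  le_of_tendsto (tendsto_qPoch hq1 a).norm (Eventually.of_forall fun n => norm_qPoch_le hq1 a n)

/-! ### Uniformly bounded coefficient families and the power series they define. -/

/-- The family of sequences `f x` is bounded, uniformly for `x` in the disc of radius `R`. -/
def BddFamily (R : ℝ) (f : ℂ → ℕ → ℂ) : Prop :=
  ∃ C : ℝ, ∀ x, ‖x‖ ≤ R → ∀ n, ‖f x n‖ ≤ C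

lemma BddFamily.mul {R : ℝ} {f g : ℂ → ℕ → ℂ} (hf : BddFamily R f) (hg : BddFamily R g) :
    BddFamily R fun x n => f x n * g x n := by
  obtain ⟨C, hC⟩ := hf
  obtain ⟨D, hD⟩ := hg
  refine ⟨C * D, fun x hx n => ?_⟩
  rw [norm_mul]
  exact mul_le_mul (hC x hx n) (hD x hx n) (norm_nonneg _) ((norm_nonneg _).trans (hC x hx n))

lemma bddFamily_continuous (R : ℝ) {g : ℂ → ℂ} (hg : Continuous g) :
    BddFamily R fun x _ => g x := by
  obtain ⟨C, hC⟩ := (isCompact_closedBall (0 : ℂ) R).exists_bound_of_continuousOn hg.continuousOn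
  exact ⟨C, fun x hx _ => hC x (by simpa using hx)⟩

lemma bddFamily_mul_pow {q : ℂ} (hq1 : ‖q‖ < 1) (R : ℝ) {g : ℂ → ℂ} (hg : Continuous g)
    (k : ℕ → ℕ) : BddFamily R fun x n => g x * q ^ k n := by
  refine (bddFamily_continuous R hg).mul ⟨1, fun x _ n => ?_⟩
  rw [norm_pow]
  exact pow_le_one₀ (norm_nonneg _) hq1.le

lemma BddFamily.one_sub {R : ℝ} {f : ℂ → ℕ → ℂ} (hf : BddFamily R f) :
    BddFamily R fun x n => 1 - f x n := by
  obtain ⟨C, hC⟩ := hf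
  refine ⟨1 + C, fun x hx n => (norm_sub_le _ _).trans ?_⟩
  simpa using hC x hx n

lemma bddFamily_qPoch {q : ℂ} (hq1 : ‖q‖ < 1) (R : ℝ) {g : ℂ → ℂ} (hg : Continuous g) :
    BddFamily R fun x n => qPoch q (g x) n := by
  obtain ⟨C, hC⟩ := bddFamily_continuous R hg
  refine ⟨Real.exp (C * (1 - ‖q‖)⁻¹), fun x hx n => (norm_qPoch_le hq1 _ n).trans ?_⟩
  have : 0 < (1 - ‖q‖)⁻¹ := inv_pos.mpr (by linarith)
  gcongr
  exact hC x hx n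

lemma bddFamily_qPochInf {q : ℂ} (hq1 : ‖q‖ < 1) (R : ℝ) {g : ℂ → ℂ} (hg : Continuous g) :
    BddFamily R fun x n => qPochInf q (g x * q ^ n) := by
  obtain ⟨C, hC⟩ := bddFamily_mul_pow hq1 R hg id
  refine ⟨Real.exp (C * (1 - ‖q‖)⁻¹), fun x hx n => (norm_qPochInf_le hq1 _).trans ?_⟩
  have : 0 < (1 - ‖q‖)⁻¹ := inv_pos.mpr (by linarith)
  gcongr
  exact hC x hx n

/-- The inverses converge because the limit `(a;q)_∞` is nonzero, and a convergent sequence is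
bounded. -/
lemma bddFamily_inv_qPoch {q : ℂ} (hq1 : ‖q‖ < 1) (R : ℝ) {a : ℂ} (ha : qPochInf q a ≠ 0) :
    BddFamily R fun _ n => (qPoch q a n)⁻¹ := by
  obtain ⟨C, hC⟩ := ((tendsto_qPoch hq1 a).inv₀ ha).norm.bddAbove_range
  exact ⟨C, fun _ _ n => hC ⟨n, rfl⟩⟩

lemma qPochInf_self_ne_zero {q : ℂ} (hq0 : q ≠ 0) (hq1 : ‖q‖ < 1) : qPochInf q q ≠ 0 := by
  refine qPochInf_ne_zero hq1 ?_
  rintro ⟨n, hn⟩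
  have h1 : q ^ (n + 1) = 1 := by
    rw [pow_succ]
    nth_rewrite 2 [hn]
    exact mul_inv_cancel₀ (pow_ne_zero _ hq0)
  have h2 : ‖q‖ ^ (n + 1) < 1 := pow_lt_one₀ (norm_nonneg _) hq1 (by omega)
  rw [← norm_pow, h1] at h2
  simp at h2

lemma BddFamily.exists_forall_norm_le {R : ℝ} {f : ℂ → ℕ → ℂ} (hf : BddFamily R f) {x : ℂ}
    (hx : ‖x‖ ≤ R) : ∃ C, ∀ n, ‖f x n‖ ≤ C :=
  hf.imp fun _ h n => h x hx n

lemma summable_bounded_mul_pow {f : ℕ → ℂ} {z : ℂ} (hf : ∃ C, ∀ n, ‖f n‖ ≤ C) (hz : ‖z‖ < 1) :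
    Summable fun n => f n * z ^ n := by
  obtain ⟨C, hC⟩ := hf
  refine Summable.of_norm_bounded
    ((summable_geometric_of_lt_one (norm_nonneg z) hz).mul_left C) fun n => ?_
  rw [norm_mul, norm_pow]
  gcongr
  exact hC n

lemma tendsto_bounded_mul_pow {f : ℕ → ℂ} {z : ℂ} (hf : ∃ C, ∀ n, ‖f n‖ ≤ C) (hz : ‖z‖ < 1) :
    Tendsto (fun n => f n * z ^ n) atTop (𝓝 0) :=
  (summable_bounded_mul_pow hf hz).tendsto_atTop_zero

/-- Uniform boundedness on discs gives a geometric majorant, so a locally uniform limit of entire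
functions is taken. -/
lemma differentiable_tsum_bddFamily {f : ℂ → ℕ → ℂ} {z : ℂ} (hf : ∀ R, BddFamily R f)
    (hd : ∀ n, Differentiable ℂ fun x => f x n) (hz : ‖z‖ < 1) :
    Differentiable ℂ fun x => ∑' n, f x n * z ^ n := by
  intro x
  obtain ⟨C, hC⟩ := hf (‖x‖ + 1)
  have := Complex.differentiableOn_tsum_of_summable_norm (F := fun n y => f y n * z ^ n)
    (U := Metric.ball (0 : ℂ) (‖x‖ + 1)) (u := fun n => C * ‖z‖ ^ n)
    ((summable_geometric_of_lt_one (norm_nonneg z) hz).mul_left C)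
    (fun n => ((hd n).mul_const _).differentiableOn) Metric.isOpen_ball (fun n y hy => ?_)
  · exact this.differentiableAt (Metric.isOpen_ball.mem_nhds (show x ∈ _ by simp))
  · have : ‖y‖ < ‖x‖ + 1 := by simpa using hy
    rw [norm_mul, norm_pow]
    gcongr
    exact hC y this.le n

/-! ### The nonterminating ₆W₅ summation. -/

/-- The coefficients of the regularized series `₆W₅(wbcd; b, c, d; q, qw)`. -/
noncomputable def sixTerm (q b c d w : ℂ) (n : ℕ) : ℂ :=
  (1 - w * b * c * d * q ^ (2 * n)) * qPoch q (w * b * c * d) n *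
    (qPoch q b n * qPoch q c n * qPoch q d n) *
    (qPochInf q (q * w * c * d * q ^ n) * qPochInf q (q * w * b * d * q ^ n) *
      qPochInf q (q * w * b * c * q ^ n)) * (qPoch q q n)⁻¹

/-- The regularized series `₆W₅(wbcd; b, c, d; q, qw)`. -/
noncomputable def sixSum (q b c d w : ℂ) : ℂ := ∑' n, sixTerm q b c d w n * (q * w) ^ n

/-- The antidifference used to compare `sixSum q b c d w` with `sixSum q b c d (q * w)`. -/
noncomputable def sixCert (q b c d w : ℂ) (n : ℕ) : ℂ :=
  qPoch q (w * b * c * d) n *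
    (qPoch q b n * qPoch q c n * qPoch q d n) *
    (qPochInf q (q * w * c * d * q ^ n) * qPochInf q (q * w * b * d * q ^ n) *
      qPochInf q (q * w * b * c * q ^ n)) * (qPoch q q n)⁻¹ *
    (1 - 1 * q ^ n) * (1 - q * w ^ 2 * b * c * d * q ^ n)

variable {q : ℂ}

lemma bddFamily_sixTerm (hq0 : q ≠ 0) (hq1 : ‖q‖ < 1) (b c d : ℂ) (R : ℝ) :
    BddFamily R (sixTerm q b c d) := by
  refine .mul (.mul (.mul (.mul ?_ ?_) ?_) ?_) ?_
  · exact (bddFamily_mul_pow hq1 R (by fun_prop) _).one_sub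
  · exact bddFamily_qPoch hq1 R (by fun_prop)
  · exact ((bddFamily_qPoch hq1 R (by fun_prop)).mul (bddFamily_qPoch hq1 R (by fun_prop))).mul
      (bddFamily_qPoch hq1 R (by fun_prop))
  · exact ((bddFamily_qPochInf hq1 R (by fun_prop)).mul
      (bddFamily_qPochInf hq1 R (by fun_prop))).mul (bddFamily_qPochInf hq1 R (by fun_prop))
  · exact bddFamily_inv_qPoch hq1 R (qPochInf_self_ne_zero hq0 hq1)

lemma bddFamily_sixCert (hq0 : q ≠ 0) (hq1 : ‖q‖ < 1) (b c d : ℂ) (R : ℝ) :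
    BddFamily R (sixCert q b c d) := by
  refine .mul (.mul (.mul (.mul (.mul ?_ ?_) ?_) ?_) ?_) ?_
  · exact bddFamily_qPoch hq1 R (by fun_prop)
  · exact ((bddFamily_qPoch hq1 R (by fun_prop)).mul (bddFamily_qPoch hq1 R (by fun_prop))).mul
      (bddFamily_qPoch hq1 R (by fun_prop))
  · exact ((bddFamily_qPochInf hq1 R (by fun_prop)).mul
      (bddFamily_qPochInf hq1 R (by fun_prop))).mul (bddFamily_qPochInf hq1 R (by fun_prop))
  · exact bddFamily_inv_qPoch hq1 R (qPochInf_self_ne_zero hq0 hq1)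
  · exact (bddFamily_mul_pow hq1 R (by fun_prop) _).one_sub
  · exact (bddFamily_mul_pow hq1 R (by fun_prop) _).one_sub

/-- Termwise form of the contiguous relation between `w` and `qw`, with `sixCert` as certificate.
Once all symbols are brought to a common index, only a polynomial identity in `q^n` remains. -/
lemma sixTerm_telescope (hq1 : ‖q‖ < 1) (b c d w : ℂ) (n : ℕ) :
    (1 - q * w) * (sixTerm q b c d w n * (q * w) ^ n) -
      (1 - w * b * c * d) * ((1 - q * w * b) * (1 - q * w * c) * (1 - q * w * d)) *
        (sixTerm q b c d (q * w) n * (q * (q * w)) ^ n) =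
      sixCert q b c d w n * (q * w) ^ n - sixCert q b c d w (n + 1) * (q * w) ^ (n + 1) := by
  have hA : (1 - w * b * c * d) * qPoch q (q * w * b * c * d) n =
      qPoch q (w * b * c * d) n * (1 - w * b * c * d * q ^ n) := by
    rw [← qPoch_succ, qPoch_succ']
    ring_nf
  have hq : (qPoch q q (n + 1))⁻¹ * (1 - 1 * q ^ (n + 1)) = (qPoch q q n)⁻¹ := by
    have h := qPoch_self_ne_zero hq1 (n + 1)
    rw [qPoch_succ] at h ⊢
    have h1 := left_ne_zero_of_mul h
    have h2 := right_ne_zero_of_mul h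
    rw [pow_succ']
    field_simp
  have hp (x : ℂ) : qPochInf q (x * q ^ n) = (1 - x * q ^ n) * qPochInf q (x * q ^ (n + 1)) := by
    rw [qPochInf_eq_mul hq1, pow_succ, mul_assoc]
  have hp' (x y : ℂ) : qPochInf q (q * (q * w) * x * y * q ^ n) =
      qPochInf q (q * w * x * y * q ^ (n + 1)) := by
    congr 1
    ring
  have h2 : q ^ (2 * n) = q ^ n * q ^ n := by ring
  have h3 : (q * (q * w)) ^ n = q ^ n * (q * w) ^ n := mul_pow _ _ _
  simp only [sixTerm, sixCert, hp']
  simp only [hp, qPoch_succ q b, qPoch_succ q c, qPoch_succ q d, qPoch_succ q (w * b * c * d), h2, h3,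
    pow_succ (q * w) n]
  simp only [pow_succ q n] at hq ⊢
  generalize qPochInf q (q * w * c * d * (q ^ n * q)) = I₁
  generalize qPochInf q (q * w * b * d * (q ^ n * q)) = I₂
  generalize qPochInf q (q * w * b * c * (q ^ n * q)) = I₃
  generalize qPoch q b n = Pb at *
  generalize qPoch q c n = Pc at *
  generalize qPoch q d n = Pd at *
  generalize qPoch q (w * b * c * d) n = PA at *
  generalize qPoch q (q * w * b * c * d) n = PA' at *
  generalize (qPoch q q n)⁻¹ = Q at *
  generalize (qPoch q q (n + 1))⁻¹ = Q' at *
  generalize q ^ n = y at *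
  generalize (q * w) ^ n = Z at *
  linear_combination
    (-((1 - q * w * b) * (1 - q * w * c) * (1 - q * w * d)) * (1 - q * w * b * c * d * (y * y)) *
      (Pb * Pc * Pd) * (I₁ * I₂ * I₃) * Q * (y * Z)) * hA +
    PA * (1 - w * b * c * d * y) * (Pb * (1 - b * y) * (Pc * (1 - c * y)) * (Pd * (1 - d * y))) *
      (I₁ * I₂ * I₃) * (1 - q * w ^ 2 * b * c * d * (y * q)) * (Z * (q * w)) * hq

lemma sixSum_eq_mul (hq0 : q ≠ 0) (hq1 : ‖q‖ < 1) (b c d w : ℂ) (hw : ‖q * w‖ < 1) :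
    (1 - q * w) * sixSum q b c d w =
      (1 - w * b * c * d) * ((1 - q * w * b) * (1 - q * w * c) * (1 - q * w * d)) *
        sixSum q b c d (q * w) := by
  have hw' : ‖q * (q * w)‖ < 1 := by
    rw [norm_mul]
    exact mul_lt_one_of_nonneg_of_lt_one_left (norm_nonneg _) hq1 hw.le
  have hs (v : ℂ) (hv : ‖q * v‖ < 1) : Summable fun n => sixTerm q b c d v n * (q * v) ^ n :=
    summable_bounded_mul_pow ((bddFamily_sixTerm hq0 hq1 b c d _).exists_forall_norm_le le_rfl) hv
  have h1 := ((hs w hw).hasSum.mul_left (1 - q * w)).sub ((hs _ hw').hasSum.mul_left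
    ((1 - w * b * c * d) * ((1 - q * w * b) * (1 - q * w * c) * (1 - q * w * d))))
  have h2 : Tendsto (fun n => sixCert q b c d w n * (q * w) ^ n) atTop (𝓝 0) :=
    tendsto_bounded_mul_pow ((bddFamily_sixCert hq0 hq1 b c d _).exists_forall_norm_le le_rfl) hw
  have h3 := h1.tendsto_sum_nat
  simp only [sixTerm_telescope hq1, Finset.sum_range_sub'] at h3
  -- The lower boundary term is zero because `sixCert` contains the factor `1 - q^n`; the upper one
  -- tends to zero since its coefficients are bounded.
  have h4 : Tendsto (fun n => sixCert q b c d w 0 * (q * w) ^ 0 -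
      sixCert q b c d w n * (q * w) ^ n) atTop (𝓝 0) := by
    simpa [sixCert] using h2.neg
  exact sub_eq_zero.mp (tendsto_nhds_unique h3 h4)

/-- For `‖w‖ < 1` the terms are dominated by `C‖q‖^n`. Continuity at 0 provides the limit when the
relation `w ↦ qw` is iterated. -/
lemma continuousAt_sixSum (hq0 : q ≠ 0) (hq1 : ‖q‖ < 1) (b c d : ℂ) :
    ContinuousAt (sixSum q b c d) 0 := by
  obtain ⟨C, hC⟩ := bddFamily_sixTerm hq0 hq1 b c d 1
  have hcont (n : ℕ) : Continuous fun w => sixTerm q b c d w n := by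
    have h1 (k : ℕ) (f : ℂ → ℂ) (hf : Continuous f) : Continuous fun w => qPoch q (f w) k :=
      (differentiable_qPoch q k).continuous.comp hf
    have h2 (f : ℂ → ℂ) (hf : Continuous f) : Continuous fun w => qPochInf q (f w) :=
      (differentiable_qPochInf hq1).continuous.comp hf
    unfold sixTerm
    refine .mul (.mul (.mul (.mul (by fun_prop) (h1 _ _ (by fun_prop))) (by fun_prop)) ?_)
      (by fun_prop)
    exact .mul (.mul (h2 _ (by fun_prop)) (h2 _ (by fun_prop))) (h2 _ (by fun_prop))
  have := continuousOn_tsum (f := fun n w => sixTerm q b c d w n * (q * w) ^ n)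
    (s := Metric.ball (0 : ℂ) 1) (u := fun n => C * ‖q‖ ^ n)
    (fun n => ((hcont n).mul (by fun_prop)).continuousOn)
    ((summable_geometric_of_lt_one (norm_nonneg q) hq1).mul_left C) (fun n w hw => ?_)
  · exact this.continuousAt (Metric.isOpen_ball.mem_nhds (by simp))
  · have hw' : ‖w‖ ≤ 1 := by simpa using (Metric.mem_ball.mp hw).le
    rw [norm_mul, norm_pow]
    have : ‖q * w‖ ≤ ‖q‖ := by
      rw [norm_mul]
      exact mul_le_of_le_one_right (norm_nonneg _) hw'
    have := hC w hw' n
    gcongr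
    exact (norm_nonneg _).trans this

lemma sixSum_zero (b c d : ℂ) : sixSum q b c d 0 = 1 := by
  rw [sixSum, tsum_eq_single 0]
  · simp [sixTerm, qPoch_zero, qPochInf_zero]
  · intro n hn
    simp [hn]

/-- The nonterminating `₆W₅` summation formula. -/
theorem sixSum_eval (hq0 : q ≠ 0) (hq1 : ‖q‖ < 1) (b c d w : ℂ) (hw : ‖q * w‖ < 1) :
    qPochInf q (q * w) * sixSum q b c d w =
      qPochInf q (w * b * c * d) * (qPochInf q (q * w * b) * qPochInf q (q * w * c) *
        qPochInf q (q * w * d)) := by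
  -- Iterating the contiguous relation moves `w` to `q^n w`, which tends to 0, where the series
  -- equals 1; the accumulated factors become the infinite products.
  have key (n : ℕ) : qPoch q (q * w) n * sixSum q b c d w =
      qPoch q (w * b * c * d) n * (qPoch q (q * w * b) n * qPoch q (q * w * c) n *
        qPoch q (q * w * d) n) * sixSum q b c d (q ^ n * w) := by
    induction n with
    | zero => simp [qPoch_zero]
    | succ n ih =>
      have hn : ‖q * (q ^ n * w)‖ < 1 := by
        rw [mul_left_comm, norm_mul, norm_pow]
        exact mul_lt_one_of_nonneg_of_lt_one_right (pow_le_one₀ (norm_nonneg _) hq1.le)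
          (norm_nonneg _) hw
      have h := sixSum_eq_mul hq0 hq1 b c d (q ^ n * w) hn
      rw [show q * (q ^ n * w) = q ^ (n + 1) * w by ring] at h
      simp only [qPoch_succ]
      linear_combination (1 - q * w * q ^ n) * ih + qPoch q (w * b * c * d) n *
        (qPoch q (q * w * b) n * qPoch q (q * w * c) n * qPoch q (q * w * d) n) * h
  have h1 := (tendsto_qPoch hq1 (q * w)).mul_const (sixSum q b c d w)
  have h0 : Tendsto (fun n : ℕ => q ^ n * w) atTop (𝓝 0) := by
    simpa using (tendsto_pow_atTop_nhds_zero_of_norm_lt_one hq1).mul_const w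
  have h2 := ((tendsto_qPoch hq1 (w * b * c * d)).mul (((tendsto_qPoch hq1 (q * w * b)).mul
    (tendsto_qPoch hq1 (q * w * c))).mul (tendsto_qPoch hq1 (q * w * d)))).mul
    ((continuousAt_sixSum hq0 hq1 b c d).tendsto.comp h0)
  rw [sixSum_zero, mul_one] at h2
  refine tendsto_nhds_unique h1 (h2.congr fun n => ?_)
  rw [key]
  rfl

/-! ### Regularized and normalized ₈W₇ series. -/

/-- The coefficients of the regularized `₈W₇` series as a function of its parameters. -/
noncomputable def uTerm (q w b c d t a : ℂ) (n : ℕ) : ℂ :=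
  (1 - a * b * c * d * w / q * t ^ 2 * q ^ (2 * n)) * qPoch q (a * b * c * d * w / q * t ^ 2) n *
    (qPoch q (a * b * c * d * w / q) n * (qPoch q q n)⁻¹ * (qPoch q (q * t ^ 2) n)⁻¹ *
    (qPoch q (a * t) n * qPoch q (b * t) n * qPoch q (c * t) n * qPoch q (d * t) n) *
    (qPochInf q (b * c * d * w * t * q ^ n) * qPochInf q (a * c * d * w * t * q ^ n) *
      qPochInf q (a * b * d * w * t * q ^ n) * qPochInf q (a * b * c * w * t * q ^ n)))

/-- The regularized `₈W₇` series. -/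
noncomputable def uSum (q w b c d t a : ℂ) : ℂ := ∑' n, uTerm q w b c d t a n * (q * w) ^ n

/-- The coefficients of `uSum q w b c d t a / (abcdwt²/q; q)_∞`. -/
noncomputable def nTerm (q w b c d t a : ℂ) (n : ℕ) : ℂ :=
  (1 - a * b * c * d * w / q * t ^ 2 * q ^ (2 * n)) *
    (qPochInf q (a * b * c * d * w / q * t ^ 2 * q ^ n))⁻¹ *
    (qPoch q (a * b * c * d * w / q) n * (qPoch q q n)⁻¹ * (qPoch q (q * t ^ 2) n)⁻¹ *
    (qPoch q (a * t) n * qPoch q (b * t) n * qPoch q (c * t) n * qPoch q (d * t) n) *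
    (qPochInf q (b * c * d * w * t * q ^ n) * qPochInf q (a * c * d * w * t * q ^ n) *
      qPochInf q (a * b * d * w * t * q ^ n) * qPochInf q (a * b * c * w * t * q ^ n)))

/-- The normalized `₈W₇` series `uSum q w b c d t a / (abcdwt²/q; q)_∞`. -/
noncomputable def nSum (q w b c d t a : ℂ) : ℂ :=
  uSum q w b c d t a / qPochInf q (a * b * c * d * w / q * t ^ 2)

variable {w t : ℂ}

lemma uTerm_swap (b c d a : ℂ) (n : ℕ) : uTerm q w b c d t a n = uTerm q w a c d t b n := by
  rw [uTerm, uTerm, mul_comm a b]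
  ring

/-- This symmetry lets results on analyticity in the last argument be used for `b` as well. -/
lemma uSum_swap (b c d a : ℂ) : uSum q w b c d t a = uSum q w a c d t b := by
  simp only [uSum, uTerm_swap b c d a]

lemma qPochInf_ne_zero_of_sq (hq0 : q ≠ 0) (hq1 : ‖q‖ < 1) (ht : t ^ 2 ∉ qAll q) :
    qPochInf q (q * t ^ 2) ≠ 0 := by
  refine qPochInf_ne_zero hq1 ?_
  rintro ⟨n, hn⟩
  refine ht ⟨-(n : ℤ) - 1, ?_⟩
  rw [zpow_sub₀ hq0, zpow_neg, zpow_natCast, zpow_one, ← hn]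
  field_simp

lemma bddFamily_uTerm (hq0 : q ≠ 0) (hq1 : ‖q‖ < 1) (ht : t ^ 2 ∉ qAll q) (b c d : ℂ) (R : ℝ) :
    BddFamily R (uTerm q w b c d t) := by
  have h (f : ℂ → ℂ) (hf : Continuous f) := bddFamily_qPoch hq1 R hf
  have h' (f : ℂ → ℂ) (hf : Continuous f) := bddFamily_qPochInf hq1 R hf
  refine .mul (.mul ?_ (h _ (by fun_prop))) (.mul (.mul (.mul (.mul (h _ (by fun_prop)) ?_) ?_) ?_)
    ?_)
  · exact (bddFamily_mul_pow hq1 R (by fun_prop) _).one_sub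
  · exact bddFamily_inv_qPoch hq1 R (qPochInf_self_ne_zero hq0 hq1)
  · exact bddFamily_inv_qPoch hq1 R (qPochInf_ne_zero_of_sq hq0 hq1 ht)
  · exact .mul (.mul (.mul (h _ (by fun_prop)) (h _ (by fun_prop))) (h _ (by fun_prop)))
      (h _ (by fun_prop))
  · exact .mul (.mul (.mul (h' _ (by fun_prop)) (h' _ (by fun_prop))) (h' _ (by fun_prop)))
      (h' _ (by fun_prop))

/-- The regularization has removed every denominator that depends on `a`: only `(q;q)_n` and
`(qt²;q)_n` remain, so the sum is entire in `a`. -/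
lemma differentiable_uSum (hq0 : q ≠ 0) (hq1 : ‖q‖ < 1) (hw : ‖q * w‖ < 1) (ht : t ^ 2 ∉ qAll q)
    (b c d : ℂ) : Differentiable ℂ (uSum q w b c d t) := by
  refine differentiable_tsum_bddFamily (bddFamily_uTerm hq0 hq1 ht b c d) (fun n => ?_) hw
  have h1 (k : ℕ) (f : ℂ → ℂ) (hf : Differentiable ℂ f) : Differentiable ℂ fun x => qPoch q (f x) k :=
    (differentiable_qPoch q k).comp hf
  have h2 (f : ℂ → ℂ) (hf : Differentiable ℂ f) : Differentiable ℂ fun x => qPochInf q (f x) :=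
    (differentiable_qPochInf hq1).comp hf
  unfold uTerm
  refine .mul (.mul (by fun_prop) (h1 _ _ (by fun_prop))) (.mul (.mul (.mul (.mul
    (h1 _ _ (by fun_prop)) (by fun_prop)) (by fun_prop)) ?_) ?_)
  · exact .mul (.mul (.mul (h1 _ _ (by fun_prop)) (h1 _ _ (by fun_prop))) (h1 _ _ (by fun_prop)))
      (h1 _ _ (by fun_prop))
  · exact .mul (.mul (.mul (h2 _ (by fun_prop)) (h2 _ (by fun_prop))) (h2 _ (by fun_prop)))
      (h2 _ (by fun_prop))

lemma inv_qPochInf_mul_pow (hq1 : ‖q‖ < 1) {A : ℂ} (hA : qPochInf q A ≠ 0) (n : ℕ) :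
    (qPochInf q (A * q ^ n))⁻¹ = qPoch q A n * (qPochInf q A)⁻¹ := by
  have h2 := qPochInf_eq hq1 A n
  rw [h2] at hA ⊢
  have h3 := left_ne_zero_of_mul hA
  have h4 := right_ne_zero_of_mul hA
  field_simp

lemma hasSum_nTerm (hq0 : q ≠ 0) (hq1 : ‖q‖ < 1) (hw : ‖q * w‖ < 1) (ht : t ^ 2 ∉ qAll q)
    (b c d a : ℂ) (hA : qPochInf q (a * b * c * d * w / q * t ^ 2) ≠ 0) :
    HasSum (fun n => nTerm q w b c d t a n * (q * w) ^ n) (nSum q w b c d t a) := by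
  have h := (summable_bounded_mul_pow
    ((bddFamily_uTerm (w := w) hq0 hq1 ht b c d _).exists_forall_norm_le (le_refl ‖a‖)) hw).hasSum.div_const
      (qPochInf q (a * b * c * d * w / q * t ^ 2))
  have e : (fun n => nTerm q w b c d t a n * (q * w) ^ n) = fun n =>
      uTerm q w b c d t a n * (q * w) ^ n / qPochInf q (a * b * c * d * w / q * t ^ 2) := by
    funext n
    rw [nTerm, uTerm, inv_qPochInf_mul_pow hq1 hA]
    ring
  rw [e]
  exact h

/-! ### The three-term recurrence by creative telescoping. -/

/-- The coefficient of `m t` in the recurrence. -/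
noncomputable def recK (q w a b c d t : ℂ) : ℂ :=
  (1 + q) * (1 + (a * b + a * c + a * d + b * c + b * d + c * d) / q + a * b * c * d / q ^ 2) +
    (1 / w + a * b * c * d * w / q) * ((q * t ^ 2 - 1) * (t ^ 2 - q) / (q * t ^ 2)) -
    (t + t⁻¹) * ((a + b + c + d) + (b * c * d + a * c * d + a * b * d + a * b * c) / q)

/-- The factor `∏ (1 - xs)` over the four parameters `x`. -/
def fourFactor (a b c d s : ℂ) : ℂ := (1 - a * s) * (1 - b * s) * (1 - c * s) * (1 - d * s)

/-- The coefficient of `m (q⁻¹ t)` in the recurrence. -/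
noncomputable def recC (q w t : ℂ) : ℂ :=
  (q * t ^ 2 - 1) * (1 - t ^ 2 / q) * (1 - t ^ 2) / (w * t ^ 2)

/-- The coefficient of `m (q t)` in the recurrence, without the factors depending on `a, b, c, d`. -/
noncomputable def recA (q w t : ℂ) : ℂ :=
  (t ^ 2 - q) * (q ^ 2 * w * t ^ 2) / ((1 - q * t ^ 2) * (1 - q ^ 2 * t ^ 2))

/-- The antidifference in the proof of the recurrence for `nSum`. -/
noncomputable def nCert (q w b c d t a : ℂ) (n : ℕ) : ℂ :=
  (qPochInf q (a * b * c * d * w / q * t ^ 2 * q ^ n))⁻¹ *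
    ((1 - a * b * c * d * w / q / q) * qPoch q (a * b * c * d * w / q) n *
      (qPoch q q (n + 1))⁻¹ * (qPoch q (q * t ^ 2) (n + 1))⁻¹ *
    (qPoch q (a * t) (n + 1) * qPoch q (b * t) (n + 1) * qPoch q (c * t) (n + 1) *
      qPoch q (d * t) (n + 1)) *
    (qPochInf q (b * c * d * w * t * q ^ n) * qPochInf q (a * c * d * w * t * q ^ n) *
      qPochInf q (a * b * d * w * t * q ^ n) * qPochInf q (a * b * c * w * t * q ^ n)))

lemma BddFamily.shift {R : ℝ} {f : ℂ → ℕ → ℂ} (hf : BddFamily R f) :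
    BddFamily R fun x n => f x (n + 1) :=
  hf.imp fun _ h x hx n => h x hx (n + 1)

lemma bddFamily_nCert (hq0 : q ≠ 0) (hq1 : ‖q‖ < 1) (ht : t ^ 2 ∉ qAll q) (b c d a : ℂ)
    (hA : qPochInf q (a * b * c * d * w / q * t ^ 2) ≠ 0) (R : ℝ) :
    BddFamily R fun _ => nCert q w b c d t a := by
  have h (x : ℂ) : BddFamily R fun _ n => qPoch q x n :=
    bddFamily_qPoch hq1 R (g := fun _ => x) (by fun_prop)
  have h' (x : ℂ) : BddFamily R fun _ n => qPochInf q (x * q ^ n) :=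
    bddFamily_qPochInf hq1 R (g := fun _ => x) (by fun_prop)
  have h'' (x : ℂ) : BddFamily R fun _ _ => x := bddFamily_continuous R (by fun_prop)
  refine .mul ?_ (.mul (.mul (.mul (.mul (.mul (h'' _) (h _)) ?_) ?_) ?_) ?_)
  · have := (h (a * b * c * d * w / q * t ^ 2)).mul
      (h'' (qPochInf q (a * b * c * d * w / q * t ^ 2))⁻¹)
    refine (congrArg (BddFamily R) (funext fun _ => funext fun n => ?_)).mpr this
    exact inv_qPochInf_mul_pow hq1 hA n
  · exact (bddFamily_inv_qPoch hq1 R (qPochInf_self_ne_zero hq0 hq1)).shift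
  · exact (bddFamily_inv_qPoch hq1 R (qPochInf_ne_zero_of_sq hq0 hq1 ht)).shift
  · exact .mul (.mul (.mul (h _).shift (h _).shift) (h _).shift) (h _).shift
  · exact .mul (.mul (.mul (h' _) (h' _)) (h' _)) (h' _)

/-- The rational core of the telescoping, with `Y = q^(m+1)`. The four parameters enter only through
their elementary symmetric functions `s₁, s₂, s₃, e`, so the identity is stated in those; this keeps
the polynomials small. -/
lemma telescope_identity {q w t : ℂ} (hq : q ≠ 0) (hw : w ≠ 0) (ht : t ≠ 0) (s₁ s₂ s₃ e B Y : ℂ)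
    (hB : B = e * w / q) :
    (t ^ 2 - q) * (q ^ 2 * w * t ^ 2) *
      (1 - s₁ * (q * t)⁻¹ + s₂ * (q * t)⁻¹ ^ 2 - s₃ * (q * t)⁻¹ ^ 3 + e * (q * t)⁻¹ ^ 4) *
      ((1 - B * t ^ 2 * Y ^ 2) * (1 - Y) * (1 - q * Y) * (1 - B * t ^ 2 * Y) *
        (1 - B * t ^ 2 * Y / q)) -
    (t ^ 2 - 1) * ((1 + q) * (1 + s₂ / q + e / q ^ 2) +
        (1 / w + e * w / q) * ((q * t ^ 2 - 1) * (t ^ 2 - q) / (q * t ^ 2)) -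
        (t + t⁻¹) * (s₁ + s₃ / q)) * (q * w) *
      ((1 - B * t ^ 2 * Y ^ 2) * (1 - B * Y / q) * (1 - q * Y) * (1 - q * t ^ 2 * Y) *
        (1 - B * t ^ 2 * Y / q)) +
    (q * t ^ 2 - 1) / (w * t ^ 2) * (q * w) ^ 2 *
      (1 - s₁ * (t / q) + s₂ * (t / q) ^ 2 - s₃ * (t / q) ^ 3 + e * (t / q) ^ 4) *
      ((1 - B * t ^ 2 * Y ^ 2) * (1 - B * Y / q) * (1 - B * Y) * (1 - t ^ 2 * Y) *
        (1 - q * t ^ 2 * Y)) =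
    (q * t ^ 2 - 1) * (1 - t ^ 2 / q) * (1 - t ^ 2) / (w * t ^ 2) * (1 - B / q) *
      ((q * w) ^ 2 * (1 - s₁ * (t * Y) + s₂ * (t * Y) ^ 2 - s₃ * (t * Y) ^ 3 + e * (t * Y) ^ 4) *
          ((1 - B * Y / q) * (1 - B * t ^ 2 * Y / q)) -
        (q * w) * (1 - s₃ * (w * t * Y / q) + s₂ * e * (w * t * Y / q) ^ 2 -
          s₁ * e ^ 2 * (w * t * Y / q) ^ 3 + e ^ 3 * (w * t * Y / q) ^ 4) *
          ((1 - q * Y) * (1 - q * t ^ 2 * Y))) := by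
  subst hB
  field_simp
  ring
-- The same for the initial terms left over by the index shifts.
lemma telescope_identity_zero {q w t : ℂ} (hq : q ≠ 0) (hw : w ≠ 0) (ht : t ≠ 0)
    (s₁ s₂ s₃ e B : ℂ) (hB : B = e * w / q) :
    -(t ^ 2 - 1) * ((1 + q) * (1 + s₂ / q + e / q ^ 2) +
        (1 / w + e * w / q) * ((q * t ^ 2 - 1) * (t ^ 2 - q) / (q * t ^ 2)) -
        (t + t⁻¹) * (s₁ + s₃ / q)) *
      ((1 - B * t ^ 2) * (1 - B * t ^ 2 / q) * (1 - q) * (1 - q * t ^ 2)) +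
    (q * t ^ 2 - 1) * (1 - t ^ 2 / q) * (1 - t ^ 2) / (w * t ^ 2) *
      (1 - s₃ * (w * t / q) + s₂ * e * (w * t / q) ^ 2 -
        s₁ * e ^ 2 * (w * t / q) ^ 3 + e ^ 3 * (w * t / q) ^ 4) * ((1 - q) * (1 - q * t ^ 2)) +
    (q * t ^ 2 - 1) / (w * t ^ 2) * (1 - t ^ 2) * (q * w) *
      (1 - s₁ * (t / q) + s₂ * (t / q) ^ 2 - s₃ * (t / q) ^ 3 + e * (t / q) ^ 4) *
      ((1 - B * t ^ 2) * (1 - B) * (1 - q * t ^ 2)) =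
    (q * t ^ 2 - 1) * (1 - t ^ 2 / q) * (1 - t ^ 2) / (w * t ^ 2) * (1 - B / q) *
      (q * w) * (1 - s₁ * t + s₂ * t ^ 2 - s₃ * t ^ 3 + e * t ^ 4) * (1 - B * t ^ 2 / q) := by
  subst hB
  field_simp
  ring

lemma inv_qPoch_self_succ (hq1 : ‖q‖ < 1) (n : ℕ) :
    (qPoch q q n)⁻¹ = (qPoch q q (n + 1))⁻¹ * (1 - q ^ (n + 1)) := by
  have h := qPoch_self_ne_zero hq1 (n + 1)
  rw [qPoch_succ, ← pow_succ'] at h ⊢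
  have h1 := left_ne_zero_of_mul h
  have h2 := right_ne_zero_of_mul h
  field_simp

lemma inv_qPoch_succ {a : ℂ} (ha : qPoch q a (n + 1) ≠ 0) :
    (qPoch q a n)⁻¹ = (qPoch q a (n + 1))⁻¹ * (1 - a * q ^ n) := by
  rw [qPoch_succ] at ha ⊢
  have h1 := left_ne_zero_of_mul ha
  have h2 := right_ne_zero_of_mul ha
  field_simp

lemma inv_qPochInf_mul (hq1 : ‖q‖ < 1) {a : ℂ} (ha : qPochInf q a ≠ 0) :
    (qPochInf q (a * q))⁻¹ = (qPochInf q a)⁻¹ * (1 - a) := by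
  rw [qPochInf_eq_mul hq1 a] at ha ⊢
  have h1 := left_ne_zero_of_mul ha
  have h2 := right_ne_zero_of_mul ha
  field_simp

lemma qPochInf_mul_pow_ne_zero (hq1 : ‖q‖ < 1) {a : ℂ} (ha : qPochInf q a ≠ 0) (n : ℕ) :
    qPochInf q (a * q ^ n) ≠ 0 := by
  rw [qPochInf_eq hq1 a n] at ha
  exact right_ne_zero_of_mul ha

lemma one_sub_sq_mul_ne_zero (ht : t ^ 2 ∉ qAll q) (k : ℤ) : 1 - q ^ k * t ^ 2 ≠ 0 := by
  intro h
  refine ht ⟨-k, ?_⟩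
  rw [zpow_neg]
  exact eq_inv_of_mul_eq_one_right (by linear_combination -h)

lemma sq_mul_notMem_qAll (hq0 : q ≠ 0) (ht : t ^ 2 ∉ qAll q) (k : ℤ) : (q ^ k * t) ^ 2 ∉ qAll q := by
  rintro ⟨n, hn⟩
  refine ht ⟨n - 2 * k, ?_⟩
  have h : (q ^ k) ^ 2 = q ^ (2 * k) := by
    rw [← zpow_natCast, ← zpow_mul, mul_comm]
    norm_cast
  have h' := zpow_ne_zero (2 * k) hq0
  rw [zpow_sub₀ hq0, ← hn, mul_pow, h]
  field_simp

lemma qPoch_sq_ne_zero (hq0 : q ≠ 0) (ht : t ^ 2 ∉ qAll q) (n : ℕ) :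
    qPoch q (q * t ^ 2) n ≠ 0 := by
  refine Finset.prod_ne_zero_iff.mpr fun k _ => ?_
  have := one_sub_sq_mul_ne_zero ht (k + 1)
  rw [zpow_add₀ hq0, zpow_natCast, zpow_one] at this
  convert this using 2
  ring

/-- The common factor of the terms in the telescoping identity. -/
noncomputable def nCommon (q w b c d t a : ℂ) (m : ℕ) : ℂ :=
  qPoch q (a * b * c * d * w / q) m * (qPoch q q (m + 2))⁻¹ * (qPoch q (q * t ^ 2) (m + 2))⁻¹ *
    (qPochInf q (a * b * c * d * w / q * t ^ 2 * q ^ m))⁻¹ *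
    (qPoch q (a * t) (m + 1) * qPoch q (b * t) (m + 1) * qPoch q (c * t) (m + 1) *
      qPoch q (d * t) (m + 1)) *
    (qPochInf q (b * c * d * w * t * q ^ (m + 1)) * qPochInf q (a * c * d * w * t * q ^ (m + 1)) *
      qPochInf q (a * b * d * w * t * q ^ (m + 1)) * qPochInf q (a * b * c * w * t * q ^ (m + 1)))

/-- This lemma and the next four factor each ingredient of the telescoping as `nCommon` times a
rational expression, polynomial in `q^m`. -/
lemma recA_mul_nTerm (hq1 : ‖q‖ < 1) (ht : t ^ 2 ∉ qAll q) (b c d a : ℂ) (m : ℕ)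
    (hA : qPochInf q (a * b * c * d * w / q * t ^ 2) ≠ 0) :
    recA q w t * fourFactor a b c d t * nTerm q w b c d (q * t) a m =
      nCommon q w b c d t a m * ((t ^ 2 - q) * (q ^ 2 * w * t ^ 2)) *
      ((1 - a * b * c * d * w / q * t ^ 2 * (q * q ^ m) ^ 2) * (1 - q * q ^ m) *
        (1 - q * (q * q ^ m)) * (1 - a * b * c * d * w / q * t ^ 2 * (q * q ^ m)) *
        (1 - a * b * c * d * w / q * t ^ 2 * q ^ m)) := by
  have hx (x : ℂ) : (1 - x * t) * qPoch q (x * (q * t)) m = qPoch q (x * t) (m + 1) := by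
    rw [qPoch_succ', mul_left_comm, mul_comm q]
  have hI (x : ℂ) : qPochInf q (x * (q * t) * q ^ m) = qPochInf q (x * t * q ^ (m + 1)) := by
    congr 1
    ring
  have h1 := one_sub_sq_mul_ne_zero ht 1
  have h2 := one_sub_sq_mul_ne_zero ht 2
  norm_cast at h1 h2
  rw [pow_one] at h1
  -- The denominator of `recA` supplies exactly the two factors that extend `(q³t²;q)_m` to
  -- `(qt²;q)_{m+2}`.
  have hd : recA q w t * (qPoch q (q * (q * t) ^ 2) m)⁻¹ =
      (t ^ 2 - q) * (q ^ 2 * w * t ^ 2) * (qPoch q (q * t ^ 2) (m + 2))⁻¹ := by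
    rw [qPoch_succ', qPoch_succ', show q * (q * t) ^ 2 = q * t ^ 2 * q * q by ring, recA,
      show q * t ^ 2 * q = q ^ 2 * t ^ 2 by ring]
    simp only [mul_inv]
    field_simp
  have hA' := qPochInf_mul_pow_ne_zero hq1 hA
  have hp : (qPochInf q (a * b * c * d * w / q * (q * t) ^ 2 * q ^ m))⁻¹ =
      (qPochInf q (a * b * c * d * w / q * t ^ 2 * q ^ m))⁻¹ *
        (1 - a * b * c * d * w / q * t ^ 2 * q ^ m) *
        (1 - a * b * c * d * w / q * t ^ 2 * q ^ (m + 1)) := by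
    rw [← inv_qPochInf_mul hq1 (hA' m), mul_assoc _ _ q, ← pow_succ,
      ← inv_qPochInf_mul hq1 (hA' (m + 1))]
    congr 2
    ring
  rw [nTerm, nCommon, hp, inv_qPoch_self_succ hq1, inv_qPoch_self_succ hq1 (m + 1), fourFactor,
    ← hx a, ← hx b, ← hx c, ← hx d]
  rw [hI (b * c * d * w), hI (a * c * d * w), hI (a * b * d * w), hI (a * b * c * w)]
  rw [show a * b * c * d * w / q * (q * t) ^ 2 * q ^ (2 * m) =
    a * b * c * d * w / q * t ^ 2 * (q * q ^ m) ^ 2 by ring, pow_succ' q (m + 1), pow_succ' q m]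
  generalize qPochInf q _ * qPochInf q _ * qPochInf q _ * qPochInf q _ = I
  generalize (qPochInf q (a * b * c * d * w / q * t ^ 2 * q ^ m))⁻¹ = ip
  generalize a * b * c * d * w / q = B at *
  linear_combination (1 - B * t ^ 2 * (q * q ^ m) ^ 2) * ip * (1 - B * t ^ 2 * q ^ m) *
    (1 - B * t ^ 2 * (q * q ^ m)) * qPoch q B m * (qPoch q q (m + 2))⁻¹ * (1 - q * q ^ m) *
    (1 - q * (q * q ^ m)) * ((1 - a * t) * (1 - b * t) * (1 - c * t) * (1 - d * t)) *
    (qPoch q (a * (q * t)) m * qPoch q (b * (q * t)) m * qPoch q (c * (q * t)) m *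
      qPoch q (d * (q * t)) m) * I * hd

lemma nTerm_succ (hq0 : q ≠ 0) (hq1 : ‖q‖ < 1) (ht : t ^ 2 ∉ qAll q) (b c d a : ℂ) (m : ℕ)
    (hA : qPochInf q (a * b * c * d * w / q * t ^ 2) ≠ 0) :
    nTerm q w b c d t a (m + 1) =
      nCommon q w b c d t a m *
      ((1 - a * b * c * d * w / q * t ^ 2 * (q * q ^ m) ^ 2) *
        (1 - a * b * c * d * w / q * q ^ m) *
        (1 - q * (q * q ^ m)) * (1 - q * t ^ 2 * (q * q ^ m)) *
        (1 - a * b * c * d * w / q * t ^ 2 * q ^ m)) := by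
  have hA' := qPochInf_mul_pow_ne_zero hq1 hA
  have hp : (qPochInf q (a * b * c * d * w / q * t ^ 2 * q ^ (m + 1)))⁻¹ =
      (qPochInf q (a * b * c * d * w / q * t ^ 2 * q ^ m))⁻¹ *
        (1 - a * b * c * d * w / q * t ^ 2 * q ^ m) := by
    rw [← inv_qPochInf_mul hq1 (hA' m), mul_assoc _ _ q, ← pow_succ]
  rw [nTerm, nCommon, hp, inv_qPoch_self_succ hq1 (m + 1),
    inv_qPoch_succ (qPoch_sq_ne_zero hq0 ht (m + 1 + 1)), qPoch_succ q (a * b * c * d * w / q)]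
  ring

lemma recC_mul_nTerm (hq0 : q ≠ 0) (ht : t ^ 2 ∉ qAll q) (b c d a : ℂ) (m : ℕ) :
    recC q w t * nTerm q w b c d (q⁻¹ * t) a (m + 2) =
      nCommon q w b c d t a m * ((q * t ^ 2 - 1) / (w * t ^ 2)) *
      fourFactor a b c d (t / q) *
      ((1 - a * b * c * d * w / q * t ^ 2 * (q * q ^ m) ^ 2) *
        (1 - a * b * c * d * w / q * q ^ m) * (1 - a * b * c * d * w / q * (q * q ^ m)) *
        (1 - t ^ 2 * (q * q ^ m)) * (1 - q * t ^ 2 * (q * q ^ m))) := by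
  have hx (x : ℂ) : qPoch q (x * (q⁻¹ * t)) (m + 2) = (1 - x * (t / q)) * qPoch q (x * t) (m + 1) := by
    rw [qPoch_succ', show x * (q⁻¹ * t) * q = x * t by field_simp, div_eq_inv_mul]
  have hI (x : ℂ) : qPochInf q (x * (q⁻¹ * t) * q ^ (m + 2)) =
      qPochInf q (x * t * q ^ (m + 1)) := by
    congr 1
    field_simp
    ring
  have hd : recC q w t * (qPoch q (q * (q⁻¹ * t) ^ 2) (m + 2))⁻¹ =
      (q * t ^ 2 - 1) / (w * t ^ 2) * (1 - t ^ 2 * (q * q ^ m)) * (1 - q * t ^ 2 * (q * q ^ m)) *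
        (qPoch q (q * t ^ 2) (m + 2))⁻¹ := by
    have h1 : qPoch q (q * (q⁻¹ * t) ^ 2) (m + 2) =
        (1 - t ^ 2 / q) * (1 - t ^ 2) * qPoch q (q * t ^ 2) m := by
      rw [qPoch_succ', qPoch_succ', show q * (q⁻¹ * t) ^ 2 * q * q = q * t ^ 2 by field_simp,
        show q * (q⁻¹ * t) ^ 2 * q = t ^ 2 by field_simp,
        show q * (q⁻¹ * t) ^ 2 = t ^ 2 / q by field_simp]
      ring
    have h2 := one_sub_sq_mul_ne_zero ht (-1)
    have h3 := one_sub_sq_mul_ne_zero ht 0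
    rw [zpow_neg_one, ← div_eq_inv_mul] at h2
    rw [zpow_zero, one_mul] at h3
    have h4 := mul_inv_cancel₀ (mul_ne_zero h2 h3)
    rw [h1, mul_inv _ (qPoch _ _ _), inv_qPoch_succ (qPoch_sq_ne_zero hq0 ht (m + 1)),
      inv_qPoch_succ (qPoch_sq_ne_zero hq0 ht (m + 1 + 1)), recC]
    generalize ((1 - t ^ 2 / q) * (1 - t ^ 2))⁻¹ = E at *
    linear_combination (q * t ^ 2 - 1) / (w * t ^ 2) * (1 - t ^ 2 * (q * q ^ m)) *
      (1 - q * t ^ 2 * (q * q ^ m)) * (qPoch q (q * t ^ 2) (m + 2))⁻¹ * h4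
  have hp : qPochInf q (a * b * c * d * w / q * (q⁻¹ * t) ^ 2 * q ^ (m + 2)) =
      qPochInf q (a * b * c * d * w / q * t ^ 2 * q ^ m) := by
    congr 1
    field_simp
    ring
  rw [nTerm, nCommon, hp, hx, hx, hx, hx, hI (b * c * d * w), hI (a * c * d * w),
    hI (a * b * d * w), hI (a * b * c * w), fourFactor, qPoch_succ q (a * b * c * d * w / q) (m + 1),
    qPoch_succ q (a * b * c * d * w / q) m]
  rw [show a * b * c * d * w / q * (q⁻¹ * t) ^ 2 * q ^ (2 * (m + 2)) =
    a * b * c * d * w / q * t ^ 2 * (q * q ^ m) ^ 2 by field_simp; ring, pow_succ' q m]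
  generalize qPochInf q _ * qPochInf q _ * qPochInf q _ * qPochInf q _ = I
  generalize (qPochInf q (a * b * c * d * w / q * t ^ 2 * q ^ m))⁻¹ = ip
  generalize a * b * c * d * w / q = B at *
  linear_combination (1 - B * t ^ 2 * (q * q ^ m) ^ 2) * ip * (qPoch q B m * (1 - B * q ^ m) *
    (1 - B * (q * q ^ m))) * (qPoch q q (m + 2))⁻¹ *
    ((1 - a * (t / q)) * (1 - b * (t / q)) * (1 - c * (t / q)) * (1 - d * (t / q))) *
    (qPoch q (a * t) (m + 1) * qPoch q (b * t) (m + 1) * qPoch q (c * t) (m + 1) *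
      qPoch q (d * t) (m + 1)) * I * hd

lemma nCert_eq (hq0 : q ≠ 0) (hq1 : ‖q‖ < 1) (ht : t ^ 2 ∉ qAll q) (b c d a : ℂ) (m : ℕ) :
    nCert q w b c d t a m =
      nCommon q w b c d t a m * (1 - a * b * c * d * w / q / q) *
      ((1 - b * c * d * w * t * q ^ m) * (1 - a * c * d * w * t * q ^ m) *
        (1 - a * b * d * w * t * q ^ m) * (1 - a * b * c * w * t * q ^ m)) *
      ((1 - q * (q * q ^ m)) * (1 - q * t ^ 2 * (q * q ^ m))) := by
  have hI (x : ℂ) : qPochInf q (x * q ^ m) = (1 - x * q ^ m) * qPochInf q (x * q ^ (m + 1)) := by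
    rw [qPochInf_eq_mul hq1, pow_succ, mul_assoc]
  rw [nCert, nCommon, inv_qPoch_self_succ hq1 (m + 1),
    inv_qPoch_succ (qPoch_sq_ne_zero hq0 ht (m + 1 + 1)), hI (b * c * d * w * t),
    hI (a * c * d * w * t), hI (a * b * d * w * t), hI (a * b * c * w * t)]
  ring

lemma nCert_succ (hq1 : ‖q‖ < 1) (b c d a : ℂ) (m : ℕ)
    (hA : qPochInf q (a * b * c * d * w / q * t ^ 2) ≠ 0) :
    nCert q w b c d t a (m + 1) =
      nCommon q w b c d t a m * (1 - a * b * c * d * w / q / q) *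
      fourFactor a b c d (t * (q * q ^ m)) *
      ((1 - a * b * c * d * w / q * q ^ m) * (1 - a * b * c * d * w / q * t ^ 2 * q ^ m)) := by
  have hA' := qPochInf_mul_pow_ne_zero hq1 hA
  have hp : (qPochInf q (a * b * c * d * w / q * t ^ 2 * q ^ (m + 1)))⁻¹ =
      (qPochInf q (a * b * c * d * w / q * t ^ 2 * q ^ m))⁻¹ *
        (1 - a * b * c * d * w / q * t ^ 2 * q ^ m) := by
    rw [← inv_qPochInf_mul hq1 (hA' m), mul_assoc _ _ q, ← pow_succ]
  rw [nCert, nCommon, hp, qPoch_succ q (a * b * c * d * w / q), qPoch_succ q (a * t),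
    qPoch_succ q (b * t), qPoch_succ q (c * t), qPoch_succ q (d * t), fourFactor, pow_succ' q m]
  ring

lemma fourFactor_eq (a b c d s : ℂ) :
    fourFactor a b c d s = 1 - (a + b + c + d) * s +
      (a * b + a * c + a * d + b * c + b * d + c * d) * s ^ 2 -
      (b * c * d + a * c * d + a * b * d + a * b * c) * s ^ 3 + a * b * c * d * s ^ 4 := by
  rw [fourFactor]
  ring

lemma prod_triples_eq (a b c d s y : ℂ) :
    (1 - b * c * d * w * s * y) * (1 - a * c * d * w * s * y) *
        (1 - a * b * d * w * s * y) * (1 - a * b * c * w * s * y) =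
      1 - (b * c * d + a * c * d + a * b * d + a * b * c) * (w * s * y) +
      (a * b + a * c + a * d + b * c + b * d + c * d) * (a * b * c * d) * (w * s * y) ^ 2 -
      (a + b + c + d) * (a * b * c * d) ^ 2 * (w * s * y) ^ 3 +
      (a * b * c * d) ^ 3 * (w * s * y) ^ 4 := by
  ring

/-- The indices `m`, `m + 1`, `m + 2` are staggered because the series base is proportional to `t²`:
with these shifts the very-well-poised factor `1 - Bt²q^(2m+2)`, where `B = abcdw/q`, is the same in
all three terms. -/
lemma nTerm_step (hq0 : q ≠ 0) (hq1 : ‖q‖ < 1) (hw0 : w ≠ 0) (ht0 : t ≠ 0) (ht : t ^ 2 ∉ qAll q)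
    (b c d a : ℂ) (hA : qPochInf q (a * b * c * d * w / q * t ^ 2) ≠ 0) (m : ℕ) :
    recA q w t * fourFactor a b c d t * fourFactor a b c d (q * t)⁻¹ *
        (nTerm q w b c d (q * t) a m * (q * w) ^ m) -
      (t ^ 2 - 1) * recK q w a b c d t * (nTerm q w b c d t a (m + 1) * (q * w) ^ (m + 1)) +
      recC q w t * (nTerm q w b c d (q⁻¹ * t) a (m + 2) * (q * w) ^ (m + 2)) =
    recC q w t * (nCert q w b c d t a (m + 1) * (q * w) ^ (m + 2) -
      nCert q w b c d t a m * (q * w) ^ (m + 1)) := by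
  have h1 := recA_mul_nTerm hq1 ht b c d a m hA
  have h2 := nTerm_succ hq0 hq1 ht b c d a m hA
  have h3 := recC_mul_nTerm (w := w) hq0 ht b c d a m
  have h4 := nCert_eq (w := w) hq0 hq1 ht b c d a m
  have h5 := nCert_succ (w := w) hq1 b c d a m hA
  have h6 := telescope_identity hq0 hw0 ht0 (a + b + c + d)
    (a * b + a * c + a * d + b * c + b * d + c * d)
    (b * c * d + a * c * d + a * b * d + a * b * c) (a * b * c * d) (a * b * c * d * w / q)
    (q * q ^ m) rfl
  have hy (x : ℂ) : x * (q * q ^ m) / q = x * q ^ m := by field_simp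
  rw [hy, hy, show w * t * (q * q ^ m) / q = w * t * q ^ m by field_simp] at h6
  rw [prod_triples_eq] at h4
  rw [fourFactor_eq] at h3 h5
  rw [fourFactor_eq a b c d (q * t)⁻¹]
  generalize (fourFactor a b c d t) = Ft at *
  rw [recC] at *
  rw [recK]
  generalize a + b + c + d = s₁ at *
  generalize a * b + a * c + a * d + b * c + b * d + c * d = s₂ at *
  generalize b * c * d + a * c * d + a * b * d + a * b * c = s₃ at *
  generalize a * b * c * d * w / q = B at *
  generalize a * b * c * d = e at *
  have h7 : (q * w) ^ (m + 1) = (q * w) ^ m * (q * w) := pow_succ _ _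
  have h8 : (q * w) ^ (m + 2) = (q * w) ^ m * (q * w) ^ 2 := pow_add _ _ _
  rw [h7, h8]
  generalize (q * w) ^ m = Z at *
  generalize q ^ m = y at *
  generalize nCommon q w b c d t a m = N at *
  linear_combination (1 - s₁ * (q * t)⁻¹ + s₂ * (q * t)⁻¹ ^ 2 - s₃ * (q * t)⁻¹ ^ 3 +
      e * (q * t)⁻¹ ^ 4) * Z * h1 -
    (t ^ 2 - 1) * ((1 + q) * (1 + s₂ / q + e / q ^ 2) +
        (1 / w + B) * ((q * t ^ 2 - 1) * (t ^ 2 - q) / (q * t ^ 2)) -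
        (t + t⁻¹) * (s₁ + s₃ / q)) * (Z * (q * w)) * h2 + Z * (q * w) ^ 2 * h3 -
    (q * t ^ 2 - 1) * (1 - t ^ 2 / q) * (1 - t ^ 2) / (w * t ^ 2) *
      (Z * (q * w) ^ 2 * h5 - Z * (q * w) * h4) + N * Z * h6

/-- Staggering leaves over the term 0 at `t` and the terms 0 and 1 at `q⁻¹t`. They add up to the
antidifference at 0, so no boundary contribution survives in the full sum. -/
lemma nTerm_step_zero (hq0 : q ≠ 0) (hq1 : ‖q‖ < 1) (hw0 : w ≠ 0) (ht0 : t ≠ 0)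
    (ht : t ^ 2 ∉ qAll q) (b c d a : ℂ)
    (hA : qPochInf q (a * b * c * d * w / q * (q⁻¹ * t) ^ 2) ≠ 0) :
    -((t ^ 2 - 1) * recK q w a b c d t * nTerm q w b c d t a 0) +
      recC q w t * (nTerm q w b c d (q⁻¹ * t) a 0 + nTerm q w b c d (q⁻¹ * t) a 1 * (q * w)) =
    recC q w t * (nCert q w b c d t a 0 * (q * w)) := by
  have hp1 : (qPochInf q (a * b * c * d * w / q * (q⁻¹ * t) ^ 2))⁻¹ *
      (1 - a * b * c * d * w / q * (q⁻¹ * t) ^ 2) =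
      (qPochInf q (a * b * c * d * w / q * t ^ 2 / q))⁻¹ := by
    rw [← inv_qPochInf_mul hq1 hA]
    congr 2
    field_simp
  have hp2 : (qPochInf q (a * b * c * d * w / q * t ^ 2))⁻¹ =
      (qPochInf q (a * b * c * d * w / q * t ^ 2 / q))⁻¹ *
        (1 - a * b * c * d * w / q * t ^ 2 / q) := by
    have hA' : qPochInf q (a * b * c * d * w / q * t ^ 2 / q) ≠ 0 := by
      convert qPochInf_mul_pow_ne_zero hq1 hA 1 using 2
      field_simp
    rw [← inv_qPochInf_mul hq1 hA']
    congr 2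
    field_simp
  have hp3 : qPochInf q (a * b * c * d * w / q * (q⁻¹ * t) ^ 2 * q) =
      qPochInf q (a * b * c * d * w / q * t ^ 2 / q) := by
    congr 1
    field_simp
  have hI (x : ℂ) : qPochInf q (x * (q⁻¹ * t)) = (1 - x * t / q) * qPochInf q (x * t) := by
    rw [qPochInf_eq_mul hq1, show x * (q⁻¹ * t) * q = x * t by field_simp,
      show x * (q⁻¹ * t) = x * t / q by field_simp]
  have hI' (x : ℂ) : qPochInf q (x * (q⁻¹ * t) * q) = qPochInf q (x * t) := by
    congr 1
    field_simp
  have ha (x : ℂ) : x * (q⁻¹ * t) = x * (t / q) := by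
    field_simp
  have h1 := one_sub_sq_mul_ne_zero ht (-1)
  have h2 := one_sub_sq_mul_ne_zero ht 1
  rw [zpow_neg_one, ← div_eq_inv_mul] at h1
  rw [zpow_one] at h2
  have h3 : 1 - q ≠ 0 := by
    simpa [qPoch] using qPoch_self_ne_zero hq1 1
  have e1 : nTerm q w b c d t a 0 = (1 - a * b * c * d * w / q * t ^ 2) *
      (qPochInf q (a * b * c * d * w / q * t ^ 2 / q))⁻¹ *
        (1 - a * b * c * d * w / q * t ^ 2 / q) * (qPochInf q (b * c * d * w * t) *
        qPochInf q (a * c * d * w * t) * qPochInf q (a * b * d * w * t) *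
        qPochInf q (a * b * c * w * t)) := by
    simp only [nTerm, mul_zero, pow_zero, mul_one, qPoch_zero, hp2]
    ring
  have e2 : nTerm q w b c d (q⁻¹ * t) a 0 =
      (qPochInf q (a * b * c * d * w / q * t ^ 2 / q))⁻¹ *
        ((1 - b * c * d * w * t * q⁻¹) * (1 - a * c * d * w * t * q⁻¹) *
        (1 - a * b * d * w * t * q⁻¹) * (1 - a * b * c * w * t * q⁻¹)) *
        (qPochInf q (b * c * d * w * t) *
        qPochInf q (a * c * d * w * t) * qPochInf q (a * b * d * w * t) *
        qPochInf q (a * b * c * w * t)) := by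
    simp only [nTerm, mul_zero, pow_zero, mul_one, qPoch_zero, ← hp1]
    rw [hI (b * c * d * w), hI (a * c * d * w), hI (a * b * d * w), hI (a * b * c * w)]
    ring
  have e3 : (1 - q) * (1 - t ^ 2 / q) * nTerm q w b c d (q⁻¹ * t) a 1 =
      (1 - a * b * c * d * w / q * t ^ 2) * (qPochInf q (a * b * c * d * w / q * t ^ 2 / q))⁻¹ *
        (1 - a * b * c * d * w / q) * fourFactor a b c d (t / q) *
        (qPochInf q (b * c * d * w * t) *
        qPochInf q (a * c * d * w * t) * qPochInf q (a * b * d * w * t) *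
        qPochInf q (a * b * c * w * t)) := by
    simp only [nTerm, mul_one, pow_one, qPoch_succ, qPoch_zero, pow_zero, one_mul, hp3, fourFactor]
    rw [hI' (b * c * d * w), hI' (a * c * d * w), hI' (a * b * d * w), hI' (a * b * c * w)]
    rw [show q * (q⁻¹ * t) ^ 2 = t ^ 2 / q by field_simp,
      show a * b * c * d * w / q * (q⁻¹ * t) ^ 2 * q ^ 2 = a * b * c * d * w / q * t ^ 2 by field_simp]
    simp only [ha]
    have h4 := mul_inv_cancel₀ h3
    have h5 := mul_inv_cancel₀ h1
    generalize (1 - q)⁻¹ = u at *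
    generalize (1 - t ^ 2 / q)⁻¹ = v at *
    linear_combination ((1 - a * b * c * d * w / q * t ^ 2) *
      (qPochInf q (a * b * c * d * w / q * t ^ 2 / q))⁻¹ *
      (1 - a * b * c * d * w / q) * ((1 - a * (t / q)) * (1 - b * (t / q)) * (1 - c * (t / q)) *
      (1 - d * (t / q))) *
      (qPochInf q (b * c * d * w * t) * qPochInf q (a * c * d * w * t) *
        qPochInf q (a * b * d * w * t) * qPochInf q (a * b * c * w * t))) *
      ((1 - t ^ 2 / q) * v * h4 + h5)
  have e4 : (1 - q) * (1 - q * t ^ 2) * nCert q w b c d t a 0 =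
      (qPochInf q (a * b * c * d * w / q * t ^ 2 / q))⁻¹ *
        (1 - a * b * c * d * w / q * t ^ 2 / q) *
        (1 - a * b * c * d * w / q / q) * fourFactor a b c d t *
        (qPochInf q (b * c * d * w * t) *
        qPochInf q (a * c * d * w * t) * qPochInf q (a * b * d * w * t) *
        qPochInf q (a * b * c * w * t)) := by
    simp only [nCert, zero_add, mul_one, qPoch_succ, qPoch_zero, pow_zero, one_mul, hp2, fourFactor]
    have h4 := mul_inv_cancel₀ h3
    have h5 := mul_inv_cancel₀ h2
    generalize (1 - q)⁻¹ = u at *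
    generalize (1 - q * t ^ 2)⁻¹ = v at *
    linear_combination ((qPochInf q (a * b * c * d * w / q * t ^ 2 / q))⁻¹ *
      (1 - a * b * c * d * w / q * t ^ 2 / q) *
      (1 - a * b * c * d * w / q / q) * ((1 - a * t) * (1 - b * t) * (1 - c * t) * (1 - d * t)) *
      (qPochInf q (b * c * d * w * t) * qPochInf q (a * c * d * w * t) *
        qPochInf q (a * b * d * w * t) * qPochInf q (a * b * c * w * t))) *
      ((1 - q * t ^ 2) * v * h4 + h5)
  have h6 := telescope_identity_zero hq0 hw0 ht0 (a + b + c + d)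
    (a * b + a * c + a * d + b * c + b * d + c * d)
    (b * c * d + a * c * d + a * b * d + a * b * c) (a * b * c * d) (a * b * c * d * w / q) rfl
  rw [div_eq_mul_inv (w * t) q] at h6
  rw [prod_triples_eq] at e2
  rw [fourFactor_eq] at e3 e4
  refine mul_left_cancel₀ (mul_ne_zero h3 h2) ?_
  rw [recC, recK]
  generalize a + b + c + d = s₁ at *
  generalize a * b + a * c + a * d + b * c + b * d + c * d = s₂ at *
  generalize b * c * d + a * c * d + a * b * d + a * b * c = s₃ at *
  generalize a * b * c * d * w / q = B at *
  generalize a * b * c * d = e at *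
  linear_combination -((1 - q) * (1 - q * t ^ 2)) * (t ^ 2 - 1) *
      ((1 + q) * (1 + s₂ / q + e / q ^ 2) +
        (1 / w + B) * ((q * t ^ 2 - 1) * (t ^ 2 - q) / (q * t ^ 2)) -
        (t + t⁻¹) * (s₁ + s₃ / q)) * e1 +
    (q * t ^ 2 - 1) * (1 - t ^ 2 / q) * (1 - t ^ 2) / (w * t ^ 2) *
      ((1 - q) * (1 - q * t ^ 2) * e2 - q * w * e4) +
    (q * t ^ 2 - 1) * (1 - t ^ 2) / (w * t ^ 2) * (1 - q * t ^ 2) * (q * w) * e3 +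
    (qPochInf q (B * t ^ 2 / q))⁻¹ * (qPochInf q (b * c * d * w * t) *
        qPochInf q (a * c * d * w * t) * qPochInf q (a * b * d * w * t) *
        qPochInf q (a * b * c * w * t)) * h6

/-- Partial sums in the recurrence for `nSum`. -/
lemma nTerm_partial_sum (hq0 : q ≠ 0) (hq1 : ‖q‖ < 1) (hw0 : w ≠ 0) (ht0 : t ≠ 0)
    (ht : t ^ 2 ∉ qAll q) (b c d a : ℂ)
    (hA : qPochInf q (a * b * c * d * w / q * (q⁻¹ * t) ^ 2) ≠ 0) (m : ℕ) :
    recA q w t * fourFactor a b c d t * fourFactor a b c d (q * t)⁻¹ *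
        ∑ n ∈ Finset.range m, nTerm q w b c d (q * t) a n * (q * w) ^ n -
      (t ^ 2 - 1) * recK q w a b c d t *
        ∑ n ∈ Finset.range (m + 1), nTerm q w b c d t a n * (q * w) ^ n +
      recC q w t * ∑ n ∈ Finset.range (m + 2), nTerm q w b c d (q⁻¹ * t) a n * (q * w) ^ n =
    recC q w t * (nCert q w b c d t a m * (q * w) ^ (m + 1)) := by
  have hA' : qPochInf q (a * b * c * d * w / q * t ^ 2) ≠ 0 := by
    convert qPochInf_mul_pow_ne_zero hq1 hA 2 using 2
    field_simp
  induction m with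
  | zero =>
    have := nTerm_step_zero hq0 hq1 hw0 ht0 ht b c d a hA
    simp only [Finset.sum_range_succ, Finset.sum_range_zero]
    linear_combination this
  | succ m ih =>
    have := nTerm_step hq0 hq1 hw0 ht0 ht b c d a hA' m
    rw [Finset.sum_range_succ, Finset.sum_range_succ _ (m + 1), Finset.sum_range_succ _ (m + 2)]
    linear_combination ih + this

/-- The three-term recurrence for the normalized `₈W₇` series. -/
theorem nSum_recurrence (hq0 : q ≠ 0) (hq1 : ‖q‖ < 1) (hw0 : w ≠ 0) (hw : ‖q * w‖ < 1)
    (ht0 : t ≠ 0) (ht : t ^ 2 ∉ qAll q) (b c d a : ℂ)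
    (hA : qPochInf q (a * b * c * d * w / q * (q⁻¹ * t) ^ 2) ≠ 0) :
    recA q w t * fourFactor a b c d t * fourFactor a b c d (q * t)⁻¹ * nSum q w b c d (q * t) a -
      (t ^ 2 - 1) * recK q w a b c d t * nSum q w b c d t a +
      recC q w t * nSum q w b c d (q⁻¹ * t) a = 0 := by
  have hA' : qPochInf q (a * b * c * d * w / q * t ^ 2) ≠ 0 := by
    convert qPochInf_mul_pow_ne_zero hq1 hA 2 using 2
    field_simp
  have hA'' : qPochInf q (a * b * c * d * w / q * (q * t) ^ 2) ≠ 0 := by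
    convert qPochInf_mul_pow_ne_zero hq1 hA 4 using 2
    field_simp
  have ht1 : (q * t) ^ 2 ∉ qAll q := by simpa using sq_mul_notMem_qAll hq0 ht 1
  have ht2 : (q⁻¹ * t) ^ 2 ∉ qAll q := by simpa using sq_mul_notMem_qAll hq0 ht (-1)
  have s1 := (hasSum_nTerm hq0 hq1 hw ht1 b c d a hA'').tendsto_sum_nat
  have s2 := (tendsto_add_atTop_iff_nat 1).mpr
    (hasSum_nTerm hq0 hq1 hw ht b c d a hA').tendsto_sum_nat
  have s3 := (tendsto_add_atTop_iff_nat 2).mpr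
    (hasSum_nTerm hq0 hq1 hw ht2 b c d a hA).tendsto_sum_nat
  have s4 := ((s1.const_mul (recA q w t * fourFactor a b c d t * fourFactor a b c d (q * t)⁻¹)).sub
    (s2.const_mul ((t ^ 2 - 1) * recK q w a b c d t))).add (s3.const_mul (recC q w t))
  simp only [nTerm_partial_sum hq0 hq1 hw0 ht0 ht b c d a hA] at s4
  have s5 : Tendsto (fun m => nCert q w b c d t a m * (q * w) ^ m) atTop (𝓝 0) :=
    tendsto_bounded_mul_pow ((bddFamily_nCert hq0 hq1 ht b c d a hA' ‖(0 : ℂ)‖).exists_forall_norm_le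
      (x := 0) le_rfl) hw
  have s6 := (s5.mul_const (q * w)).const_mul (recC q w t)
  rw [zero_mul, mul_zero] at s6
  refine tendsto_nhds_unique s4 (s6.congr fun m => ?_)
  ring

/-! ### The Casoratian of the normalized series. -/

/-- The factor in the Casoratian of `nSum`. -/
noncomputable def casFactor (q w t : ℂ) : ℂ :=
  q ^ 3 * w ^ 2 * t ^ 4 / ((1 - t ^ 2) * (1 - q * t ^ 2) ^ 2 * (1 - q ^ 2 * t ^ 2))

/-- The normalized Casoratian of `nSum` at `t` and `t⁻¹`. -/
noncomputable def nCas (q w b c d t a : ℂ) : ℂ :=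
  nSum q w b c d t a * nSum q w b c d (q * t)⁻¹ a -
    casFactor q w t * (fourFactor a b c d t * fourFactor a b c d (q * t)⁻¹) *
      (nSum q w b c d (q * t) a * nSum q w b c d t⁻¹ a)

/-- The constant value of `nCas`. -/
noncomputable def casConst (q w b c d a : ℂ) : ℂ :=
  qPochInf q (a * b * c * d * w / q) *
    (qPochInf q (a * b * w) * qPochInf q (a * c * w) * qPochInf q (a * d * w) *
      (qPochInf q (b * c * w) * qPochInf q (b * d * w) * qPochInf q (c * d * w))) /
    qPochInf q (q * w)

lemma inv_sq_notMem_qAll (ht : t ^ 2 ∉ qAll q) : t⁻¹ ^ 2 ∉ qAll q := by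
  rintro ⟨n, hn⟩
  refine ht ⟨-n, ?_⟩
  rw [zpow_neg, ← hn, inv_pow, inv_inv]

lemma recK_inv (a b c d : ℂ) : recK q w a b c d t⁻¹ = recK q w a b c d t := by
  by_cases ht : t = 0
  · simp [ht]
  · have h : (q * t⁻¹ ^ 2 - 1) * (t⁻¹ ^ 2 - q) / (q * t⁻¹ ^ 2) =
        (q * t ^ 2 - 1) * (t ^ 2 - q) / (q * t ^ 2) := by
      field_simp
      ring
    rw [recK, recK, h, inv_inv, add_comm t⁻¹]

/-- Multiply the recurrence at `t` by the series at `t⁻¹`, the one at `t⁻¹` by `t²` times the series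
at `t`, and add. The middle terms cancel because `recK` is even under inversion and `t² - 1` is odd
up to the factor `t²`; what remains is `recC` times the difference of two neighbouring Casoratians.
-/
lemma nCas_step (hq0 : q ≠ 0) (hq1 : ‖q‖ < 1) (hw0 : w ≠ 0) (hw : ‖q * w‖ < 1)
    (ht0 : t ≠ 0) (ht : t ^ 2 ∉ qAll q) (b c d a : ℂ)
    (hA : qPochInf q (a * b * c * d * w / q * (q⁻¹ * t) ^ 2) ≠ 0)
    (hA' : qPochInf q (a * b * c * d * w / q * (q⁻¹ * t⁻¹) ^ 2) ≠ 0) :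
    nCas q w b c d (q⁻¹ * t) a = nCas q w b c d t a := by
  have h1 := nSum_recurrence hq0 hq1 hw0 hw ht0 ht b c d a hA
  have h2 := nSum_recurrence hq0 hq1 hw0 hw (inv_ne_zero ht0) (inv_sq_notMem_qAll ht) b c d a hA'
  have g0 : 1 - t ^ 2 ≠ 0 := by simpa using one_sub_sq_mul_ne_zero ht 0
  have g1 : 1 - q * t ^ 2 ≠ 0 := by simpa using one_sub_sq_mul_ne_zero ht 1
  have g2 : 1 - q ^ 2 * t ^ 2 ≠ 0 := by exact_mod_cast one_sub_sq_mul_ne_zero ht 2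
  have g3 : 1 - t ^ 2 / q ≠ 0 := by
    simpa [div_eq_inv_mul] using one_sub_sq_mul_ne_zero ht (-1)
  have g4 : q - t ^ 2 ≠ 0 := fun h => g3 (by
    rw [show t ^ 2 = q by linear_combination -h, div_self hq0, sub_self])
  have hC : recC q w t ≠ 0 := by
    rw [recC]
    have : q * t ^ 2 - 1 ≠ 0 := fun h => g1 (by linear_combination -h)
    positivity
  have e1 : t ^ 2 * recC q w t⁻¹ = -recC q w t := by
    rw [recC, recC]
    field_simp
    ring
  have e2 : recA q w t = recC q w t * casFactor q w t := by
    rw [recA, recC, casFactor, show q * t ^ 2 - 1 = -(1 - q * t ^ 2) by ring,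
      show 1 - t ^ 2 / q = -(t ^ 2 - q) / q by field_simp; ring]
    generalize 1 - t ^ 2 = X at *
    generalize 1 - q * t ^ 2 = Y at *
    generalize 1 - q ^ 2 * t ^ 2 = Z at *
    field_simp
  have e3 : t ^ 2 * recA q w t⁻¹ = -(recC q w t * casFactor q w (q⁻¹ * t)) := by
    have g5 : t ^ 2 - q ≠ 0 := fun h => g4 (by linear_combination -h)
    have g6 : t ^ 2 - q ^ 2 ≠ 0 := by
      have := one_sub_sq_mul_ne_zero ht (-2)
      intro h
      apply this
      rw [zpow_neg, show t ^ 2 = q ^ 2 by linear_combination h]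
      norm_cast
      field_simp
      ring
    have g7 : q ^ 2 - t ^ 2 ≠ 0 := fun h => g6 (by linear_combination -h)
    have g8 : t ^ 2 - 1 ≠ 0 := fun h => g0 (by linear_combination -h)
    rw [recA, recC, casFactor]
    field_simp
    ring
  rw [recK_inv] at h2
  have r1 : (q * t⁻¹)⁻¹ = q⁻¹ * t := by rw [mul_inv, inv_inv]
  have r2 : q * (q⁻¹ * t) = t := by field_simp
  have r3 : (q⁻¹ * t)⁻¹ = q * t⁻¹ := by rw [mul_inv, inv_inv]
  have r4 : q⁻¹ * t⁻¹ = (q * t)⁻¹ := by rw [mul_inv]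
  have r5 : t ^ 2 * t⁻¹ ^ 2 = 1 := by field_simp
  rw [r1, r4] at h2
  refine mul_left_cancel₀ hC ?_
  rw [nCas, nCas, r2, r3]
  linear_combination nSum q w b c d t⁻¹ a * h1 + t ^ 2 * nSum q w b c d t a * h2 -
    fourFactor a b c d t * fourFactor a b c d (q * t)⁻¹ * nSum q w b c d (q * t) a *
      nSum q w b c d t⁻¹ a * e2 -
    fourFactor a b c d t⁻¹ * fourFactor a b c d (q⁻¹ * t) * nSum q w b c d (q * t⁻¹) a *
      nSum q w b c d t a * e3 -
    nSum q w b c d t a * nSum q w b c d (q * t)⁻¹ a * e1 +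
    recK q w a b c d t * nSum q w b c d t a * nSum q w b c d t⁻¹ a * r5

/-! ### Evaluation of the Casoratian at special parameters. -/

lemma qPoch_one_succ (n : ℕ) : qPoch q 1 (n + 1) = 0 := by
  rw [qPoch_succ', sub_self, zero_mul]

/-- The series terminates at its first term when `a t = 1`. -/
lemma uSum_of_mul_eq_one (hq1 : ‖q‖ < 1) {a : ℂ} (b c d : ℂ) (hat : a * t = 1)
    (hq0 : q ≠ 0) :
    uSum q w b c d t a = qPochInf q (a * b * c * d * w / q * t ^ 2) *
      (qPochInf q (c * d * w) * qPochInf q (b * d * w) * qPochInf q (b * c * w)) := by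
  have h0 : ∀ n, n ≠ 0 → uTerm q w b c d t a n * (q * w) ^ n = 0 := by
    intro n hn
    obtain ⟨m, rfl⟩ := Nat.exists_eq_succ_of_ne_zero hn
    rw [uTerm, hat, qPoch_one_succ]
    ring
  rw [uSum, tsum_eq_single 0 h0, qPochInf_eq_mul hq1 (a * b * c * d * w / q * t ^ 2),
    show a * b * c * d * w / q * t ^ 2 * q = b * c * d * w * t by
      field_simp
      linear_combination (b * c * d * w * t) * hat]
  simp only [uTerm, mul_zero, pow_zero, mul_one, qPoch_zero, inv_one, one_mul]
  rw [show a * c * d * w * t = c * d * w by linear_combination c * d * w * hat,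
    show a * b * d * w * t = b * d * w by linear_combination b * d * w * hat,
    show a * b * c * w * t = b * c * w by linear_combination b * c * w * hat]
  ring

/-- The series reduces to a `₆W₅` when `a = q t`. -/
lemma uSum_of_eq_mul (hq0 : q ≠ 0) (hq1 : ‖q‖ < 1) (hw : ‖q * w‖ < 1) (ht : t ^ 2 ∉ qAll q)
    (b c d : ℂ) :
    qPochInf q (q * w) * uSum q w b c d t (q * t) =
      qPochInf q (b * c * d * w * t) * qPochInf q (q * t * b * c * d * w / q * t ^ 2) *
      (qPochInf q (q * t * b * w) * qPochInf q (q * t * c * w) * qPochInf q (q * t * d * w)) := by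
  have h (n : ℕ) : uTerm q w b c d t (q * t) n =
      qPochInf q (b * c * d * w * t) * sixTerm q (b * t) (c * t) (d * t) w n := by
    have hne := qPoch_sq_ne_zero hq0 ht n
    have e1 : q * t * b * c * d * w / q * t ^ 2 = w * (b * t) * (c * t) * (d * t) := by field_simp
    have e2 : q * t * b * c * d * w / q = b * c * d * w * t := by field_simp
    rw [uTerm, sixTerm, e1, e2, qPochInf_eq hq1 (b * c * d * w * t) n,
      show q * t * t = q * t ^ 2 by ring,
      show q * t * c * d * w * t = q * w * (c * t) * (d * t) by ring,
      show q * t * b * d * w * t = q * w * (b * t) * (d * t) by ring,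
      show q * t * b * c * w * t = q * w * (b * t) * (c * t) by ring]
    linear_combination (1 - w * (b * t) * (c * t) * (d * t) * q ^ (2 * n)) *
      qPoch q (w * (b * t) * (c * t) * (d * t)) n *
      (qPoch q (b * c * d * w * t) n * (qPoch q q n)⁻¹ *
      (qPoch q (b * t) n * qPoch q (c * t) n * qPoch q (d * t) n) *
      (qPochInf q (b * c * d * w * t * q ^ n) * qPochInf q (q * w * (c * t) * (d * t) * q ^ n) *
      qPochInf q (q * w * (b * t) * (d * t) * q ^ n) *
      qPochInf q (q * w * (b * t) * (c * t) * q ^ n))) * inv_mul_cancel₀ hne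
  have h2 : uSum q w b c d t (q * t) =
      qPochInf q (b * c * d * w * t) * sixSum q (b * t) (c * t) (d * t) w := by
    rw [uSum, sixSum, ← tsum_mul_left]
    exact tsum_congr fun n => by rw [h, mul_assoc]
  have h3 := sixSum_eval hq0 hq1 (b * t) (c * t) (d * t) w hw
  rw [h2, mul_left_comm, h3, show q * t * b * c * d * w / q * t ^ 2 =
    w * (b * t) * (c * t) * (d * t) by field_simp, show q * w * (b * t) = q * t * b * w by ring,
    show q * w * (c * t) = q * t * c * w by ring, show q * w * (d * t) = q * t * d * w by ring]
  ring

/-- When `at = 1`, the factor `1 - at` annihilates the second product, the series at `t` stops at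
once, and at `u = (qt)⁻¹` one has `a = qu`, the ₆W₅ case. -/
lemma nCas_of_mul_eq_one (hq0 : q ≠ 0) (hq1 : ‖q‖ < 1) (hw : ‖q * w‖ < 1)
    (hz : qPochInf q (q * w) ≠ 0) (ht : t ^ 2 ∉ qAll q)
    (b c d : ℂ) {a : ℂ} (hat : a * t = 1)
    (hA : qPochInf q (a * b * c * d * w / q * t ^ 2) ≠ 0)
    (hA' : qPochInf q (a * b * c * d * w / q * (q * t)⁻¹ ^ 2) ≠ 0) :
    nCas q w b c d t a = casConst q w b c d a := by
  have ht0 : t ≠ 0 := right_ne_zero_of_mul_eq_one hat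
  have hu : (q * t)⁻¹ ^ 2 ∉ qAll q := inv_sq_notMem_qAll (by
    simpa using sq_mul_notMem_qAll hq0 ht 1)
  have h1 := uSum_of_mul_eq_one (w := w) hq1 b c d hat hq0
  have h2 := uSum_of_eq_mul hq0 hq1 hw hu b c d
  have ha : q * (q * t)⁻¹ = a := by
    rw [mul_inv, mul_inv_cancel_left₀ hq0]
    exact (eq_inv_of_mul_eq_one_left hat).symm
  have hB : b * c * d * w * (q * t)⁻¹ = a * b * c * d * w / q := by
    rw [← ha]
    field_simp
  rw [ha, hB] at h2
  have hF : fourFactor a b c d t = 0 := by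
    rw [fourFactor, hat]
    ring
  rw [nCas, hF, nSum, nSum, h1, casConst, eq_div_of_mul_eq hz ((mul_comm _ _).trans h2)]
  generalize qPochInf q (a * b * c * d * w / q * t ^ 2) = X at *
  generalize qPochInf q (a * b * c * d * w / q * (q * t)⁻¹ ^ 2) = Y at *
  field_simp
  ring

lemma qPochInf_zpow_mul_ne_zero (hq0 : q ≠ 0) (hq1 : ‖q‖ < 1) {x y : ℂ} (hx : x ∉ qAll q) (k : ℤ)
    (h : y = q ^ k * x) : qPochInf q y ≠ 0 := by
  refine qPochInf_ne_zero hq1 ?_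
  rintro ⟨n, hn⟩
  refine hx ⟨-n - k, ?_⟩
  have := zpow_ne_zero k hq0
  rw [zpow_sub₀ hq0, zpow_neg, zpow_natCast, ← hn, h]
  field_simp

/-- The two conditions on `abcdw t^{±2}` keep the normalizing products nonzero along the whole
orbit, so the one-step invariance can be iterated. -/
lemma nCas_pow (hq0 : q ≠ 0) (hq1 : ‖q‖ < 1) (hw0 : w ≠ 0) (hw : ‖q * w‖ < 1)
    (ht0 : t ≠ 0) (ht : t ^ 2 ∉ qAll q) (b c d a : ℂ)
    (h1 : a * b * c * d * w * t ^ 2 ∉ qAll q) (h2 : a * b * c * d * w * t⁻¹ ^ 2 ∉ qAll q) (m : ℕ) :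
    nCas q w b c d ((q ^ m)⁻¹ * t) a = nCas q w b c d t a := by
  induction m with
  | zero => simp
  | succ m ih =>
    rw [← ih, pow_succ', mul_inv, mul_assoc]
    have hqm := pow_ne_zero m hq0
    refine nCas_step hq0 hq1 hw0 hw (mul_ne_zero (inv_ne_zero hqm) ht0) ?_ b c d a ?_ ?_
    · simpa using sq_mul_notMem_qAll hq0 ht (-m)
    · refine qPochInf_zpow_mul_ne_zero hq0 hq1 h1 (-(2 * m + 3 : ℕ)) ?_
      rw [zpow_neg, zpow_natCast]
      field_simp
      ring
    · refine qPochInf_zpow_mul_ne_zero hq0 hq1 h2 (2 * m - 3) ?_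
      rw [zpow_sub₀ hq0, zpow_mul]
      norm_cast
      field_simp
      ring

/-! ### Analytic continuation of the Casoratian in the parameters. -/

/-- The Casoratian of the regularized series `uSum`. -/
noncomputable def uCas (q w b c d t a : ℂ) : ℂ :=
  uSum q w b c d t a * uSum q w b c d (q * t)⁻¹ a -
    casFactor q w t * (fourFactor a b c d t * fourFactor a b c d (q * t)⁻¹) *
      ((1 - a * b * c * d * w / q * t ^ 2) * (1 - a * b * c * d * w / q * t ^ 2 * q) *
        ((1 - a * b * c * d * w / q * (q * t)⁻¹ ^ 2) *
          (1 - a * b * c * d * w / q * (q * t)⁻¹ ^ 2 * q))) *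
      (uSum q w b c d (q * t) a * uSum q w b c d t⁻¹ a)

/-- The normalizing products at `qt` and at `t⁻¹` differ from those at `t` and at `(qt)⁻¹` by two
linear factors each. Hence two infinite products clear all denominators, leaving a function that is
entire in `a`. -/
lemma uCas_eq (hq0 : q ≠ 0) (hq1 : ‖q‖ < 1) (b c d a : ℂ)
    (hA : qPochInf q (a * b * c * d * w / q * t ^ 2) ≠ 0)
    (hA' : qPochInf q (a * b * c * d * w / q * (q * t)⁻¹ ^ 2) ≠ 0) :
    uCas q w b c d t a = qPochInf q (a * b * c * d * w / q * t ^ 2) *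
      qPochInf q (a * b * c * d * w / q * (q * t)⁻¹ ^ 2) * nCas q w b c d t a := by
  have h1 := qPochInf_eq hq1 (a * b * c * d * w / q * t ^ 2) 2
  have h2 := qPochInf_eq hq1 (a * b * c * d * w / q * (q * t)⁻¹ ^ 2) 2
  rw [show a * b * c * d * w / q * t ^ 2 * q ^ 2 = a * b * c * d * w / q * (q * t) ^ 2 by ring,
    qPoch_succ, qPoch_succ, qPoch_zero, pow_zero, pow_one, one_mul, mul_one] at h1
  rw [show a * b * c * d * w / q * (q * t)⁻¹ ^ 2 * q ^ 2 = a * b * c * d * w / q * t⁻¹ ^ 2 by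
    field_simp, qPoch_succ, qPoch_succ, qPoch_zero, pow_zero, pow_one, one_mul, mul_one] at h2
  have h3 := right_ne_zero_of_mul (h1 ▸ hA)
  have h4 := right_ne_zero_of_mul (h2 ▸ hA')
  rw [uCas, nCas, nSum, nSum, nSum, nSum]
  generalize 1 - a * b * c * d * w / q * t ^ 2 = X₁ at *
  generalize 1 - a * b * c * d * w / q * t ^ 2 * q = X₂ at *
  generalize 1 - a * b * c * d * w / q * (q * t)⁻¹ ^ 2 = Y₁ at *
  generalize 1 - a * b * c * d * w / q * (q * t)⁻¹ ^ 2 * q = Y₂ at *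
  generalize qPochInf q (a * b * c * d * w / q * t ^ 2) = P₁ at *
  generalize qPochInf q (a * b * c * d * w / q * (q * t)⁻¹ ^ 2) = P₂ at *
  generalize qPochInf q (a * b * c * d * w / q * (q * t) ^ 2) = P₃ at *
  generalize qPochInf q (a * b * c * d * w / q * t⁻¹ ^ 2) = P₄ at *
  subst h1 h2
  have hX := left_ne_zero_of_mul hA
  have hY := left_ne_zero_of_mul hA'
  have hX₁ := left_ne_zero_of_mul hX
  have hX₂ := right_ne_zero_of_mul hX
  have hY₁ := left_ne_zero_of_mul hY
  have hY₂ := right_ne_zero_of_mul hY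
  field_simp

lemma fourFactor_swap (a b c d s : ℂ) : fourFactor a b c d s = fourFactor b a c d s := by
  rw [fourFactor, fourFactor, mul_comm (1 - a * s)]

lemma uCas_swap (b c d a : ℂ) : uCas q w b c d t a = uCas q w a c d t b := by
  rw [uCas, uCas, uSum_swap, uSum_swap b, uSum_swap b, uSum_swap b, fourFactor_swap a b,
    fourFactor_swap a b, mul_comm a b]

/-- The value of `uCas`. -/
noncomputable def uCasValue (q w b c d t a : ℂ) : ℂ :=
  qPochInf q (a * b * c * d * w / q * t ^ 2) *
      qPochInf q (a * b * c * d * w / q * (q * t)⁻¹ ^ 2) * casConst q w b c d a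

lemma uCasValue_swap (b c d a : ℂ) : uCasValue q w b c d t a = uCasValue q w a c d t b := by
  rw [uCasValue, uCasValue, casConst, casConst, mul_comm a b]
  ring

lemma differentiable_uCas (hq0 : q ≠ 0) (hq1 : ‖q‖ < 1) (hw : ‖q * w‖ < 1) (ht : t ^ 2 ∉ qAll q)
    (b c d : ℂ) : Differentiable ℂ (uCas q w b c d t) := by
  have ht' : (q * t) ^ 2 ∉ qAll q := by simpa using sq_mul_notMem_qAll hq0 ht 1
  have h1 := differentiable_uSum hq0 hq1 hw ht b c d
  have h2 := differentiable_uSum hq0 hq1 hw ht' b c d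
  have h3 := differentiable_uSum hq0 hq1 hw (inv_sq_notMem_qAll ht) b c d
  have h4 := differentiable_uSum hq0 hq1 hw (inv_sq_notMem_qAll ht') b c d
  unfold uCas fourFactor
  fun_prop

lemma differentiable_uCasValue (hq1 : ‖q‖ < 1) (b c d : ℂ) :
    Differentiable ℂ (uCasValue q w b c d t) := by
  have h2 (f : ℂ → ℂ) (hf : Differentiable ℂ f) : Differentiable ℂ fun x => qPochInf q (f x) :=
    (differentiable_qPochInf hq1).comp hf
  unfold uCasValue casConst
  refine .mul (.mul (h2 _ (by fun_prop)) (h2 _ (by fun_prop))) (.div_const (.mul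
    (h2 _ (by fun_prop)) (.mul (.mul (.mul (h2 _ (by fun_prop)) (h2 _ (by fun_prop)))
      (h2 _ (by fun_prop))) (by fun_prop))) _)

lemma qPochInf_ne_zero_of_norm_lt_one (hq0 : q ≠ 0) (hq1 : ‖q‖ < 1) {z : ℂ} (hz : ‖z‖ < 1) : qPochInf q z ≠ 0 := by
  refine qPochInf_ne_zero hq1 ?_
  rintro ⟨n, rfl⟩
  rw [norm_inv, norm_pow] at hz
  exact hz.not_ge ((one_le_inv₀ (pow_pos (norm_pos_iff.mpr hq0) n)).mpr
    (pow_le_one₀ (norm_nonneg _) hq1.le))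

/-- The identity theorem in `a`, from the points `q^m t⁻¹`. At these points `abcdw t²` and `abcdw
t⁻²` are `q^m` times the two quantities in the hypotheses, so one condition on each serves for all
`m`. -/
lemma uCas_generic (hq0 : q ≠ 0) (hq1 : ‖q‖ < 1) (hw0 : w ≠ 0) (hw : ‖q * w‖ < 1)
    (ht0 : t ≠ 0) (ht : t ^ 2 ∉ qAll q) (b c d a : ℂ)
    (h1 : b * c * d * w * t ∉ qAll q) (h2 : b * c * d * w * t⁻¹ ^ 3 ∉ qAll q) :
    uCas q w b c d t a = uCasValue q w b c d t a := by
  -- Shift invariance replaces `t` by `q^(-m) t`, whose product with `a = q^m t⁻¹` is 1; there the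
  -- Casoratian is known.
  have key (m : ℕ) : uCas q w b c d t (q ^ m * t⁻¹) = uCasValue q w b c d t (q ^ m * t⁻¹) := by
    have hA (k : ℤ) (y : ℂ)
        (h : y = q ^ k * (b * c * d * w * t)) : qPochInf q y ≠ 0 :=
      qPochInf_zpow_mul_ne_zero hq0 hq1 h1 k h
    have hA' (k : ℤ) (y : ℂ)
        (h : y = q ^ k * (b * c * d * w * t⁻¹ ^ 3)) : qPochInf q y ≠ 0 :=
      qPochInf_zpow_mul_ne_zero hq0 hq1 h2 k h
    have hqm := pow_ne_zero m hq0
    have hs (x : ℂ) (hx : x ∉ qAll q) : q ^ m * x ∉ qAll q := by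
      rintro ⟨n, hn⟩
      refine hx ⟨n - m, ?_⟩
      rw [zpow_sub₀ hq0, ← hn, zpow_natCast]
      field_simp
    rw [uCas_eq hq0 hq1, uCasValue, ← nCas_pow hq0 hq1 hw0 hw ht0 ht b c d _ ?_ ?_ m,
      nCas_of_mul_eq_one hq0 hq1 hw (qPochInf_ne_zero_of_norm_lt_one hq0 hq1 hw)]
    · simpa using sq_mul_notMem_qAll hq0 ht (-m)
    · field_simp
    · apply hA (-(m + 1 : ℕ))
      rw [zpow_neg, zpow_natCast]
      field_simp
      ring
    · apply hA' (3 * m - 3)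
      rw [zpow_sub₀ hq0, zpow_mul']
      norm_cast
      field_simp
    · convert hs _ h1 using 1
      field_simp
    · convert hs _ h2 using 1
      field_simp
    · apply hA (m - 1)
      rw [zpow_sub₀ hq0]
      norm_cast
      field_simp
    · apply hA' (m - 3)
      rw [zpow_sub₀ hq0]
      norm_cast
      field_simp
  have hlim : Tendsto (fun m : ℕ => q ^ m * t⁻¹) atTop (𝓝[≠] 0) := by
    refine tendsto_nhdsWithin_iff.mpr ⟨?_, Eventually.of_forall fun m => ?_⟩
    · simpa using (tendsto_pow_atTop_nhds_zero_of_norm_lt_one hq1).mul_const t⁻¹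
    · exact mul_ne_zero (pow_ne_zero m hq0) (inv_ne_zero ht0)
  exact congrFun (AnalyticOnNhd.eq_of_frequently_eq
    ((differentiable_uCas hq0 hq1 hw ht b c d).differentiableOn.analyticOnNhd isOpen_univ)
    ((differentiable_uCasValue hq1 b c d).differentiableOn.analyticOnNhd isOpen_univ)
    (hlim.frequently (Frequently.of_forall key))) a

/-- The Casoratian of the regularized series. -/
theorem uCas_eval (hq0 : q ≠ 0) (hq1 : ‖q‖ < 1) (hw0 : w ≠ 0) (hw : ‖q * w‖ < 1)
    (ht0 : t ≠ 0) (ht : t ^ 2 ∉ qAll q) (b a : ℂ) {c d : ℂ} (hc : c ≠ 0) (hd : d ≠ 0) :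
    uCas q w b c d t a = uCasValue q w b c d t a := by
  have hcount (y : ℂ) (hy : y ≠ 0) : {x : ℂ | x * y ∈ qAll q}.Countable := by
    have : {x : ℂ | x * y ∈ qAll q} ⊆ Set.range fun n : ℤ => q ^ n * y⁻¹ := by
      rintro x ⟨n, hn⟩
      exact ⟨n, by simp only [← hn]; field_simp⟩
    exact (Set.countable_range _).mono this
  -- The excluded values of `b` are countable, here using that `c` and `d` are nonzero, so their
  -- complement is dense; the swap of `a` and `b` supplies continuity in `b`.
  have hdense := ((hcount (c * d * w * t) (by positivity)).union
    (hcount (c * d * w * t⁻¹ ^ 3) (by positivity))).dense_compl ℝ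
  rw [uCas_swap, uCasValue_swap]
  refine congrFun (Continuous.ext_on hdense (differentiable_uCas hq0 hq1 hw ht a c d).continuous
    (differentiable_uCasValue hq1 a c d).continuous fun x hx => ?_) b
  simp only [Set.mem_compl_iff, Set.mem_union, Set.mem_ofPred_eq, not_or, ← mul_assoc] at hx
  rw [uCas_swap, uCasValue_swap]
  exact uCas_generic hq0 hq1 hw0 hw ht0 ht x c d a hx.1 hx.2

theorem nCas_eval (hq0 : q ≠ 0) (hq1 : ‖q‖ < 1) (hw0 : w ≠ 0) (hw : ‖q * w‖ < 1)
    (ht0 : t ≠ 0) (ht : t ^ 2 ∉ qAll q) (b a : ℂ) {c d : ℂ} (hc : c ≠ 0) (hd : d ≠ 0)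
    (hA : qPochInf q (a * b * c * d * w / q * t ^ 2) ≠ 0)
    (hA' : qPochInf q (a * b * c * d * w / q * (q * t)⁻¹ ^ 2) ≠ 0) :
    nCas q w b c d t a = casConst q w b c d a := by
  have h := uCas_eval hq0 hq1 hw0 hw ht0 ht b a hc hd
  rw [uCas_eq hq0 hq1 b c d a hA hA', uCasValue] at h
  exact mul_left_cancel₀ (mul_ne_zero hA hA') h

/-! ### Translation between M and the normalized series. -/

lemma sigma_one (a : Fin 4 → ℂ) : sigma a 1 = a 0 + a 1 + a 2 + a 3 := by
  rw [sigma, Finset.powersetCard_one, Finset.sum_map]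
  simp [Fin.sum_univ_four]

lemma sigma_two (a : Fin 4 → ℂ) :
    sigma a 2 = a 0 * a 1 + a 0 * a 2 + a 0 * a 3 + a 1 * a 2 + a 1 * a 3 + a 2 * a 3 := by
  rw [sigma, show Finset.powersetCard 2 (Finset.univ : Finset (Fin 4)) =
    {{0, 1}, {0, 2}, {0, 3}, {1, 2}, {1, 3}, {2, 3}} by decide]
  repeat rw [Finset.sum_insert (by decide)]
  rw [Finset.sum_singleton]
  repeat rw [Finset.prod_pair (by decide)]
  ring

lemma sigma_three (a : Fin 4 → ℂ) :
    sigma a 3 = a 1 * a 2 * a 3 + a 0 * a 2 * a 3 + a 0 * a 1 * a 3 + a 0 * a 1 * a 2 := by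
  rw [sigma, show Finset.powersetCard 3 (Finset.univ : Finset (Fin 4)) =
    {{1, 2, 3}, {0, 2, 3}, {0, 1, 3}, {0, 1, 2}} by decide]
  repeat rw [Finset.sum_insert (by decide)]
  rw [Finset.sum_singleton]
  repeat rw [Finset.prod_insert (by decide), Finset.prod_pair (by decide)]
  ring

lemma sigma_four (a : Fin 4 → ℂ) : sigma a 4 = a 0 * a 1 * a 2 * a 3 := by
  have : Finset.powersetCard 4 (Finset.univ : Finset (Fin 4)) = {Finset.univ} := by decide
  rw [sigma, this, Finset.sum_singleton, Fin.prod_univ_four]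

lemma qPoch_mul_self (q s : ℂ) (n : ℕ) :
    (1 - s) * qPoch q (q * s) n = qPoch q s n * (1 - s * q ^ n) := by
  rw [← qPoch_succ, qPoch_succ', mul_comm s q]

/-- The part of `solution` which does not involve the parameters `a`. -/
noncomputable def prefactor (q qh α : ℂ) (rt : ℂ → ℂ) (t : ℂ) : ℂ :=
  rt t * (qPochInf q (q * α * t) * qPochInf q (α⁻¹ * t⁻¹) *
      qPochInf q (qh * α * t) * qPochInf q (qh * α⁻¹ * t⁻¹)) / qPochInf q (t⁻¹ ^ 2)

/-- The product `∏ (x t; q)_∞` over the four parameters `x`. -/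
noncomputable def fourPochInf (q a b c d t : ℂ) : ℂ :=
  qPochInf q (a * t) * qPochInf q (b * t) * qPochInf q (c * t) * qPochInf q (d * t)

lemma fourPochInf_eq (hq1 : ‖q‖ < 1) (a b c d : ℂ) :
    fourPochInf q a b c d t = fourFactor a b c d t * fourPochInf q a b c d (q * t) := by
  rw [fourPochInf, fourPochInf, fourFactor, qPochInf_eq_mul hq1 (a * t), qPochInf_eq_mul hq1 (b * t),
    qPochInf_eq_mul hq1 (c * t), qPochInf_eq_mul hq1 (d * t)]
  simp only [mul_assoc, mul_comm t q]
  ring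

/-- The ratio `prefactor (q t) / prefactor t`. -/
noncomputable def prefactorRatio (q w t : ℂ) : ℂ :=
  q ^ 2 * w * t ^ 2 / ((1 - q * t ^ 2) * (1 - q ^ 2 * t ^ 2))

/-- The products in `αt` and `α⁻¹t⁻¹` form theta functions, so a shift by `q` changes them only by
monomials; the branch of `t^{1/2}` contributes `qh`, and `(t⁻²;q)_∞` gives the two factors of the
denominator. -/
lemma prefactor_mul {qh α : ℂ} {rt : ℂ → ℂ} (hq0 : q ≠ 0) (hq1 : ‖q‖ < 1) (hqh : qh ^ 2 = q)
    (hrtq : rt (q * t) = qh * rt t) (hα : α ≠ 0) (ht0 : t ≠ 0) (ht : t ^ 2 ∉ qAll q) :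
    prefactor q qh α rt (q * t) = prefactorRatio q (α ^ 2)⁻¹ t * prefactor q qh α rt t := by
  have hqh0 : qh ≠ 0 := by
    rintro rfl
    exact hq0 (by rw [← hqh]; ring)
  have e1 : qPochInf q (α⁻¹ * (q * t)⁻¹) = (1 - (q * α * t)⁻¹) * qPochInf q (α⁻¹ * t⁻¹) := by
    rw [qPochInf_eq_mul hq1, show α⁻¹ * (q * t)⁻¹ = (q * α * t)⁻¹ by field_simp,
      show (q * α * t)⁻¹ * q = α⁻¹ * t⁻¹ by field_simp]
  have e2 : qPochInf q (q * α * t) = (1 - q * α * t) * qPochInf q (q * α * (q * t)) := by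
    rw [qPochInf_eq_mul hq1, show q * α * t * q = q * α * (q * t) by ring]
  have e3 : qPochInf q (qh * α⁻¹ * (q * t)⁻¹) =
      (1 - (qh * α * t)⁻¹) * qPochInf q (qh * α⁻¹ * t⁻¹) := by
    rw [qPochInf_eq_mul hq1, show qh * α⁻¹ * (q * t)⁻¹ = (qh * α * t)⁻¹ by
      rw [← hqh]; field_simp, show (qh * α * t)⁻¹ * q = qh * α⁻¹ * t⁻¹ by rw [← hqh]; field_simp]
  have e4 : qPochInf q (qh * α * t) = (1 - qh * α * t) * qPochInf q (qh * α * (q * t)) := by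
    rw [qPochInf_eq_mul hq1, show qh * α * t * q = qh * α * (q * t) by ring]
  have e5 : qPochInf q ((q * t)⁻¹ ^ 2) =
      (1 - (q * t)⁻¹ ^ 2) * (1 - (q * t)⁻¹ ^ 2 * q) * qPochInf q (t⁻¹ ^ 2) := by
    rw [qPochInf_eq hq1 _ 2, show (q * t)⁻¹ ^ 2 * q ^ 2 = t⁻¹ ^ 2 by field_simp]
    simp [qPoch, Finset.prod_range_succ]
  have g1 : 1 - q * t ^ 2 ≠ 0 := by simpa using one_sub_sq_mul_ne_zero ht 1
  have g2 : 1 - q ^ 2 * t ^ 2 ≠ 0 := by exact_mod_cast one_sub_sq_mul_ne_zero ht 2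
  have e6 : 1 - (q * t)⁻¹ ^ 2 = -(1 - q ^ 2 * t ^ 2) * (q * t)⁻¹ ^ 2 := by
    field_simp
    ring
  have e7 : 1 - (q * t)⁻¹ ^ 2 * q = -(1 - q * t ^ 2) * (q * t ^ 2)⁻¹ := by
    field_simp
    ring
  have e8 : 1 - (q * α * t)⁻¹ = -(1 - q * α * t) * (q * α * t)⁻¹ := by
    field_simp
    ring
  have e9 : 1 - (qh * α * t)⁻¹ = -(1 - qh * α * t) * (qh * α * t)⁻¹ := by
    field_simp
    ring
  rw [prefactor, prefactor, hrtq, prefactorRatio, e5, e1, e3, e2, e4, e6, e7, e8, e9]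
  generalize 1 - q * t ^ 2 = X at *
  generalize 1 - q ^ 2 * t ^ 2 = Y at *
  generalize 1 - q * α * t = Z at *
  generalize 1 - qh * α * t = V at *
  generalize qPochInf q (t⁻¹ ^ 2) = P at *
  generalize qPochInf q (α⁻¹ * t⁻¹) = P₁ at *
  generalize qPochInf q (q * α * (q * t)) = P₂ at *
  generalize qPochInf q (qh * α * (q * t)) = P₃ at *
  generalize qPochInf q (qh * α⁻¹ * t⁻¹) = P₄ at *
  -- If `(t⁻²;q)_∞ = 0`, both sides are zero by the convention for division by zero.
  by_cases hP : P = 0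
  · simp [hP]
  · field_simp

/-- The condition on `t⁻²` excludes the exponents `n ≥ 0` and the one on `qt²` excludes `n < 0`. -/
lemma Nondegenerate.sq_notMem {α : ℂ} {a : Fin 4 → ℂ} (hq0 : q ≠ 0)
    (h : Nondegenerate q α a t) : t ^ 2 ∉ qAll q := by
  rintro ⟨n, hn⟩
  rcases le_or_gt 0 n with hn0 | hn0
  · lift n to ℕ using hn0
    exact h.inv_sq ⟨n, by rw [inv_pow, hn, zpow_natCast]⟩
  · obtain ⟨k, hk⟩ := Int.eq_ofNat_of_zero_le (show 0 ≤ -1 - n by omega)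
    refine h.mul_sq ⟨k, ?_⟩
    rw [hn, show n = -1 - k by omega, zpow_sub₀ hq0, zpow_natCast, zpow_neg_one]
    field_simp

/-- The four symbols in `±√A` telescope to `(1 - Aq^(2n))/(1 - A)`, which no longer contains the
root. The lower ones do not vanish because `(1 - sq^k)(1 + sq^k) = 1 - Aq^(2k)` for `s² = A`. -/
lemma veryWellPoised_eq {A b₁ b₂ b₃ b₄ b₅ z : ℂ} (hA : A ∉ qNeg q) :
    (1 - A) * veryWellPoised A [b₁, b₂, b₃, b₄, b₅] q z =
      ∑' n : ℕ, (1 - A * q ^ (2 * n)) * qPoch q A n * (qPoch q b₁ n * qPoch q b₂ n * qPoch q b₃ n *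
        qPoch q b₄ n * qPoch q b₅ n) / (qPoch q q n * (qPoch q (q * A / b₁) n *
        qPoch q (q * A / b₂) n * qPoch q (q * A / b₃) n * qPoch q (q * A / b₄) n *
        qPoch q (q * A / b₅) n)) * z ^ n := by
  have hs : (A ^ (1 / 2 : ℂ)) ^ 2 = A := by
    rw [← Complex.cpow_nat_mul]
    norm_num
  rw [veryWellPoised, basicHyp, ← tsum_mul_left]
  refine tsum_congr fun n => ?_
  generalize A ^ (1 / 2 : ℂ) = s at *
  have h1 : qPoch q s n ≠ 0 ∧ qPoch q (-s) n ≠ 0 := by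
    rw [← mul_ne_zero_iff, qPoch, qPoch, ← Finset.prod_mul_distrib]
    refine Finset.prod_ne_zero_iff.mpr fun k _ h => hA ⟨2 * k, ?_⟩
    exact eq_inv_of_mul_eq_one_left (by rw [← hs]; linear_combination -h)
  have h2 := qPoch_mul_self q s n
  have h3 := qPoch_mul_self q (-s) n
  have h4 : (1 - A) * (qPoch q (q * s) n * qPoch q (-(q * s)) n) =
      (1 - A * q ^ (2 * n)) * (qPoch q s n * qPoch q (-s) n) := by
    rw [mul_neg] at h3
    rw [← hs]
    linear_combination (1 + s) * qPoch q (-(q * s)) n * h2 + qPoch q s n * (1 - s * q ^ n) * h3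
  simp only [List.map_cons, List.map_nil, List.prod_cons, List.prod_nil, mul_one]
  obtain ⟨h5, h6⟩ := h1
  have h7 : 1 - A * q ^ (2 * n) =
      (1 - A) * (qPoch q (q * s) n * qPoch q (-(q * s)) n) / (qPoch q s n * qPoch q (-s) n) := by
    rw [h4]
    field_simp
  rw [h7]
  simp only [div_eq_mul_inv, mul_inv]
  ring

/-- The series `nSum` in the variables of `solution`. -/
noncomputable def solSum (q α : ℂ) (a : Fin 4 → ℂ) (t : ℂ) : ℂ :=
  nSum q (α ^ 2)⁻¹ (a 1 * α) (a 2 * α) (a 3 * α) t (a 0 * α)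

lemma base_eq (a : Fin 4 → ℂ) {α : ℂ} (hα : α ≠ 0) (y : ℂ) :
    a 0 * α * (a 1 * α) * (a 2 * α) * (a 3 * α) * (α ^ 2)⁻¹ / q * y =
      q⁻¹ * sigma a 4 * α ^ 2 * y := by
  rw [sigma_four]
  field_simp

/-- The products `(a_j⁻¹σ₄αt;q)_∞` in M absorb the lower parameters of the ₈W₇, turning it into
`uSum`; the product `(σ₄α²t²;q)_∞` together with the factor `1 - A`, where `A = q⁻¹σ₄α²t²`, is the
normalization of `nSum`. -/
lemma solution_eq {qh α : ℂ} {a : Fin 4 → ℂ} (rt : ℂ → ℂ) (hq0 : q ≠ 0) (hq1 : ‖q‖ < 1)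
    (hα : α ≠ 0) (ha : ∀ j, a j ≠ 0) (h : Nondegenerate q α a t) :
    solution q qh α a rt t = prefactor q qh α rt t * solSum q α a t /
      fourPochInf q (a 0 * α) (a 1 * α) (a 2 * α) (a 3 * α) t := by
  have ht0 := h.ne_zero
  have hσ0 : sigma a 4 ≠ 0 := by
    rw [sigma_four]
    exact mul_ne_zero (mul_ne_zero (mul_ne_zero (ha 0) (ha 1)) (ha 2)) (ha 3)
  have hA := h.base
  have hA1 : qPochInf q (sigma a 4 * α ^ 2 * t ^ 2) ≠ 0 := by
    have := qPochInf_ne_zero hq1 hA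
    rw [qPochInf_eq_mul hq1] at this
    convert right_ne_zero_of_mul this using 2
    field_simp
  have hA0 : qPochInf q (q⁻¹ * sigma a 4 * α ^ 2 * t ^ 2) =
      (1 - q⁻¹ * sigma a 4 * α ^ 2 * t ^ 2) * qPochInf q (sigma a 4 * α ^ 2 * t ^ 2) := by
    rw [qPochInf_eq_mul hq1]
    congr 2
    field_simp
  have hA2 : 1 - q⁻¹ * sigma a 4 * α ^ 2 * t ^ 2 ≠ 0 := fun h0 => hA ⟨0, by
    rw [pow_zero, inv_one]; linear_combination -h0⟩
  have key : (∏ j, qPochInf q ((a j)⁻¹ * sigma a 4 * α * t)) *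
      ((1 - q⁻¹ * sigma a 4 * α ^ 2 * t ^ 2) *
        veryWellPoised (q⁻¹ * sigma a 4 * α ^ 2 * t ^ 2)
        [q⁻¹ * sigma a 4 * α ^ 2, a 0 * α * t, a 1 * α * t, a 2 * α * t, a 3 * α * t]
        q (q * (α ^ 2)⁻¹)) =
      uSum q (α ^ 2)⁻¹ (a 1 * α) (a 2 * α) (a 3 * α) t (a 0 * α) := by
    rw [veryWellPoised_eq hA, uSum, ← tsum_mul_left]
    refine tsum_congr fun n => ?_
    rw [← mul_assoc]
    congr 1
    have hl (j : Fin 4) : q * (q⁻¹ * sigma a 4 * α ^ 2 * t ^ 2) / (a j * α * t) =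
        (a j)⁻¹ * sigma a 4 * α * t := by
      have := ha j
      field_simp
    have hl' : q * (q⁻¹ * sigma a 4 * α ^ 2 * t ^ 2) / (q⁻¹ * sigma a 4 * α ^ 2) = q * t ^ 2 := by
      field_simp
    have hn (j : Fin 4) := qPoch_ne_zero (h.lower j) n
    have hn' := qPoch_ne_zero h.mul_sq n
    have hnq := qPoch_self_ne_zero hq1 n
    have hr (j : Fin 4) (y : ℂ) (hy : y = (a j)⁻¹ * sigma a 4 * α * t) :
        qPochInf q (y * q ^ n) = qPochInf q ((a j)⁻¹ * sigma a 4 * α * t) *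
          (qPoch q ((a j)⁻¹ * sigma a 4 * α * t) n)⁻¹ := by
      have := hn j
      rw [hy, qPochInf_eq hq1 ((a j)⁻¹ * sigma a 4 * α * t) n,
        mul_comm (qPoch q ((a j)⁻¹ * sigma a 4 * α * t) n), mul_inv_cancel_right₀ this]
    have h0 := ha 0
    have h1 := ha 1
    have h2 := ha 2
    have h3 := ha 3
    rw [hl, hl, hl, hl, hl', uTerm, base_eq a hα, ← mul_one (_ * (α ^ 2)⁻¹ / q), base_eq a hα,
      mul_one, hr 0 _ (by rw [sigma_four]; field_simp), hr 1 _ (by rw [sigma_four]; field_simp),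
      hr 2 _ (by rw [sigma_four]; field_simp), hr 3 _ (by rw [sigma_four]; field_simp),
      Fin.prod_univ_four]
    simp only [div_eq_mul_inv, mul_inv]
    ring
  rw [solution, prefactor, solSum, nSum, ← key, base_eq a hα, hA0, fourPochInf, Fin.prod_univ_four,
    Fin.prod_univ_four]
  generalize veryWellPoised _ _ _ _ = W
  generalize 1 - q⁻¹ * sigma a 4 * α ^ 2 * t ^ 2 = X at *
  generalize qPochInf q (sigma a 4 * α ^ 2 * t ^ 2) = Y at *
  simp only [div_eq_mul_inv, mul_inv]
  have := mul_inv_cancel₀ hA2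
  linear_combination -(rt t * (qPochInf q (q * α * t) * qPochInf q (α⁻¹ * t⁻¹) *
    qPochInf q (qh * α * t) * qPochInf q (qh * α⁻¹ * t⁻¹)) *
    (qPochInf q ((a 0)⁻¹ * sigma a 4 * α * t) * qPochInf q ((a 1)⁻¹ * sigma a 4 * α * t) *
      qPochInf q ((a 2)⁻¹ * sigma a 4 * α * t) * qPochInf q ((a 3)⁻¹ * sigma a 4 * α * t)) *
    ((qPochInf q (a 0 * α * t))⁻¹ * (qPochInf q (a 1 * α * t))⁻¹ *
      (qPochInf q (a 2 * α * t))⁻¹ * (qPochInf q (a 3 * α * t))⁻¹) *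
    (qPochInf q (t⁻¹ ^ 2))⁻¹ * Y⁻¹ * W) * this

lemma fourPochInf_ne_zero {α : ℂ} {a : Fin 4 → ℂ} (hq1 : ‖q‖ < 1) (h : Nondegenerate q α a t) :
    fourPochInf q (a 0 * α) (a 1 * α) (a 2 * α) (a 3 * α) t ≠ 0 := by
  have h' (j : Fin 4) := qPochInf_ne_zero hq1 (h.upper j)
  exact mul_ne_zero (mul_ne_zero (mul_ne_zero (h' 0) (h' 1)) (h' 2)) (h' 3)

lemma base_ne_zero {α : ℂ} {a : Fin 4 → ℂ} (hq1 : ‖q‖ < 1) (hα : α ≠ 0)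
    (h : Nondegenerate q α a t) :
    qPochInf q (a 0 * α * (a 1 * α) * (a 2 * α) * (a 3 * α) * (α ^ 2)⁻¹ / q * t ^ 2) ≠ 0 := by
  rw [base_eq a hα]
  exact qPochInf_ne_zero hq1 h.base

lemma w0_eq {qh : ℂ} (α : ℂ) (a : Fin 4 → ℂ) (s : ℂ) (hqh : qh ^ 2 = q) :
    w0 qh a (qh⁻¹ * α * s) =
      fourFactor (a 0 * α) (a 1 * α) (a 2 * α) (a 3 * α) (q⁻¹ * s) := by
  rw [w0, Fin.prod_univ_four, fourFactor, ← hqh]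
  ring

lemma bracket_eq {qh α : ℂ} (a : Fin 4 → ℂ) (hq0 : q ≠ 0) (hqh : qh ^ 2 = q)
    (ht0 : t ≠ 0) :
    (1 + q) * (1 + q⁻¹ * α ^ 2 * sigma a 2 + q⁻¹ ^ 2 * α ^ 4 * sigma a 4)
        + q⁻¹ * α ^ 2 * (q + sigma a 4) * (qh * t - qh⁻¹ * t⁻¹) * (qh⁻¹ * t - qh * t⁻¹)
        - α * (t + t⁻¹) * (sigma a 1 + q⁻¹ * α ^ 2 * sigma a 3) =
      recK q (α ^ 2)⁻¹ (a 0 * α) (a 1 * α) (a 2 * α) (a 3 * α) t := by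
  have hqh0 : qh ≠ 0 := by
    rintro rfl
    exact hq0 (by rw [← hqh]; ring)
  rw [recK, sigma_one, sigma_two, sigma_three, sigma_four, ← hqh]
  field_simp

/-! ### Recurrence and Casoratian of M. -/

lemma solution_threeTerm {qh α : ℂ} {a : Fin 4 → ℂ} {rt : ℂ → ℂ}
    (hq0 : q ≠ 0) (hq1 : ‖q‖ < 1) (hqh : qh ^ 2 = q)
    (hrtq : ∀ t : ℂ, t ≠ 0 → rt (q * t) = qh * rt t)
    (ha : ∀ j, a j ≠ 0) (hα : α ≠ 0) (hz : ‖q * (α ^ 2)⁻¹‖ < 1)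
    (h1 : Nondegenerate q α a (q * t)) (h0 : Nondegenerate q α a t)
    (hm : Nondegenerate q α a (q⁻¹ * t)) :
    ThreeTermAt q qh α a (solution q qh α a rt) t := by
  have hqh0 : qh ≠ 0 := by
    rintro rfl
    exact hq0 (by rw [← hqh]; ring)
  have ht0 := h0.ne_zero
  have ht := h0.sq_notMem hq0
  have hrec := nSum_recurrence hq0 hq1 (inv_ne_zero (pow_ne_zero 2 hα)) hz ht0 ht
    (a 1 * α) (a 2 * α) (a 3 * α) (a 0 * α) (base_ne_zero hq1 hα hm)
  have p1 := prefactor_mul hq0 hq1 hqh (hrtq t ht0) hα ht0 ht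
  have p2 := prefactor_mul hq0 hq1 hqh (hrtq _ hm.ne_zero) hα hm.ne_zero (hm.sq_notMem hq0)
  rw [mul_inv_cancel_left₀ hq0] at p2
  have f1 := fourPochInf_eq (t := t) hq1 (a 0 * α) (a 1 * α) (a 2 * α) (a 3 * α)
  have f2 := fourPochInf_eq (t := q⁻¹ * t) hq1 (a 0 * α) (a 1 * α) (a 2 * α) (a 3 * α)
  rw [mul_inv_cancel_left₀ hq0] at f2
  have n0 := fourPochInf_ne_zero hq1 h0
  have n1 := fourPochInf_ne_zero hq1 h1
  have nm := fourPochInf_ne_zero hq1 hm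
  rw [ThreeTermAt, bracket_eq a hq0 hqh ht0, w0_eq α a _ hqh, w0_eq α a _ hqh,
    solution_eq rt hq0 hq1 hα ha h0, solution_eq rt hq0 hq1 hα ha h1,
    solution_eq rt hq0 hq1 hα ha hm, f2, p1, show q⁻¹ * t⁻¹ = (q * t)⁻¹ from (mul_inv q t).symm]
  change recA q (α ^ 2)⁻¹ t * _ * _ * solSum q α a (q * t) - _ * _ * solSum q α a t +
    _ * solSum q α a (q⁻¹ * t) = 0 at hrec
  rw [f1] at n0 ⊢
  rw [f2] at nm
  have nF := left_ne_zero_of_mul nm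
  have nF' := left_ne_zero_of_mul n0
  have g1 : 1 - q * t ^ 2 ≠ 0 := by simpa using one_sub_sq_mul_ne_zero ht 1
  have g2 : 1 - q ^ 2 * t ^ 2 ≠ 0 := by exact_mod_cast one_sub_sq_mul_ne_zero ht 2
  have g0 : 1 - t ^ 2 ≠ 0 := by simpa using one_sub_sq_mul_ne_zero ht 0
  have g3 : 1 - t ^ 2 / q ≠ 0 := by
    simpa [div_eq_inv_mul] using one_sub_sq_mul_ne_zero ht (-1)
  have c1 : recA q (α ^ 2)⁻¹ t = (t ^ 2 - q) * prefactorRatio q (α ^ 2)⁻¹ t := by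
    rw [recA, prefactorRatio, mul_div_assoc]
  have c2 : recC q (α ^ 2)⁻¹ t * prefactorRatio q (α ^ 2)⁻¹ (q⁻¹ * t) = q * t ^ 2 - 1 := by
    rw [recC, prefactorRatio, show q * (q⁻¹ * t) ^ 2 = t ^ 2 / q by field_simp,
      show q ^ 2 * (q⁻¹ * t) ^ 2 = t ^ 2 by field_simp]
    generalize 1 - t ^ 2 / q = X at *
    generalize 1 - t ^ 2 = Y at *
    field_simp
  have c3 : qh⁻¹ * t - qh * t⁻¹ = (t ^ 2 - q) * (qh * t)⁻¹ := by
    rw [← hqh]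
    field_simp
  have c4 : qh * t - qh⁻¹ * t⁻¹ = (q * t ^ 2 - 1) * (qh * t)⁻¹ := by
    rw [← hqh]
    field_simp
  have c5 : qh⁻¹ * (t - t⁻¹) = (t ^ 2 - 1) * (qh * t)⁻¹ := by
    field_simp
  rw [c3, c4, c5]
  rw [c1] at hrec
  generalize fourFactor (a 0 * α) (a 1 * α) (a 2 * α) (a 3 * α) t = F at *
  generalize fourFactor (a 0 * α) (a 1 * α) (a 2 * α) (a 3 * α) (q⁻¹ * t) = Fm at *
  generalize fourFactor (a 0 * α) (a 1 * α) (a 2 * α) (a 3 * α) (q * t)⁻¹ = Fu at *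
  generalize fourPochInf q (a 0 * α) (a 1 * α) (a 2 * α) (a 3 * α) (q * t) = P at *
  generalize recK q (α ^ 2)⁻¹ (a 0 * α) (a 1 * α) (a 2 * α) (a 3 * α) t = K at *
  generalize solSum q α a t = N₀ at *
  generalize solSum q α a (q * t) = N₁ at *
  generalize solSum q α a (q⁻¹ * t) = N₂ at *
  generalize prefactor q qh α rt t = φ at *
  generalize prefactor q qh α rt (q⁻¹ * t) = φm at *
  have i1 (x : ℂ) : x / P = F * x * (F * P)⁻¹ := by field_simp
  have i2 (x : ℂ) : x / (Fm * (F * P)) = Fm⁻¹ * x * (F * P)⁻¹ := by field_simp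
  have i3 := mul_inv_cancel₀ nF
  rw [i1, i2, div_eq_mul_inv]
  linear_combination (qh * t)⁻¹ * (F * P)⁻¹ * (φ * hrec - N₂ * recC q (α ^ 2)⁻¹ t * p2 -
    φm * N₂ * c2 + (q * t ^ 2 - 1) * φm * N₂ * i3)

/-- This explains the choice of `casFactor`: passing from the arguments `t, (qt)⁻¹` to `qt, t⁻¹`
multiplies the prefactors by these two ratios. -/
lemma casFactor_eq (hq0 : q ≠ 0) (ht0 : t ≠ 0) (ht : t ^ 2 ∉ qAll q) :
    casFactor q w t = prefactorRatio q w t * prefactorRatio q w (q * t)⁻¹ := by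
  have g0 : 1 - t ^ 2 ≠ 0 := by simpa using one_sub_sq_mul_ne_zero ht 0
  have g1 : 1 - q * t ^ 2 ≠ 0 := by simpa using one_sub_sq_mul_ne_zero ht 1
  have g2 : 1 - q ^ 2 * t ^ 2 ≠ 0 := by exact_mod_cast one_sub_sq_mul_ne_zero ht 2
  rw [casFactor, prefactorRatio, prefactorRatio,
    show 1 - q * (q * t)⁻¹ ^ 2 = -(1 - q * t ^ 2) / (q * t ^ 2) by field_simp; ring,
    show 1 - q ^ 2 * (q * t)⁻¹ ^ 2 = -(1 - t ^ 2) / t ^ 2 by field_simp; ring]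
  generalize 1 - t ^ 2 = X at *
  generalize 1 - q * t ^ 2 = Y at *
  generalize 1 - q ^ 2 * t ^ 2 = Z at *
  field_simp

lemma prefactor_ne_zero {qh α : ℂ} {rt : ℂ → ℂ} (hq0 : q ≠ 0) (hq1 : ‖q‖ < 1) (hqh : qh ^ 2 = q)
    (hrt : rt t ^ 2 = t) (ht0 : t ≠ 0) (ht : t⁻¹ ^ 2 ∉ qNeg q)
    (h1 : α * t ∉ qAll q) (h2 : qh * α * t ∉ qAll q) : prefactor q qh α rt t ≠ 0 := by
  have hr : rt t ≠ 0 := by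
    intro h
    rw [h] at hrt
    exact ht0 (by rw [← hrt]; ring)
  have h1' : (α * t)⁻¹ ∉ qAll q := by
    rintro ⟨n, hn⟩
    exact h1 ⟨-n, by rw [zpow_neg, ← hn, inv_inv]⟩
  have h2' : (qh * α * t)⁻¹ ∉ qAll q := by
    rintro ⟨n, hn⟩
    exact h2 ⟨-n, by rw [zpow_neg, ← hn, inv_inv]⟩
  have hqh0 : qh ≠ 0 := by
    rintro rfl
    exact hq0 (by rw [← hqh]; ring)
  refine div_ne_zero (mul_ne_zero hr (mul_ne_zero (mul_ne_zero (mul_ne_zero ?_ ?_) ?_) ?_))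
    (qPochInf_ne_zero hq1 ht)
  · exact qPochInf_zpow_mul_ne_zero hq0 hq1 h1 1 (by rw [zpow_one, mul_assoc])
  · exact qPochInf_zpow_mul_ne_zero hq0 hq1 h1' 0 (by rw [zpow_zero, mul_inv, one_mul])
  · exact qPochInf_zpow_mul_ne_zero hq0 hq1 h2 0 (by rw [zpow_zero, one_mul])
  · exact qPochInf_zpow_mul_ne_zero hq0 hq1 h2' 1 (by
      rw [zpow_one, mul_inv, mul_inv, ← hqh]
      field_simp)

/-- With `w = α⁻²` the six pair factors become `(a_i a_j;q)_∞` and the remaining numerator factor is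
`(q⁻¹σ₄α²;q)_∞`; this is where both parameter conditions enter. -/
lemma casConst_ne_zero {α : ℂ} {a : Fin 4 → ℂ} (hq1 : ‖q‖ < 1) (hα : α ≠ 0)
    (hz : qPochInf q (q * (α ^ 2)⁻¹) ≠ 0)
    (hσ : q⁻¹ * sigma a 4 * α ^ 2 ∉ qNeg q) (ha : ∀ i j, i ≠ j → a i * a j ∉ qNeg q) :
    casConst q (α ^ 2)⁻¹ (a 1 * α) (a 2 * α) (a 3 * α) (a 0 * α) ≠ 0 := by
  have h (i j : Fin 4) (hij : i ≠ j) : qPochInf q (a i * α * (a j * α) * (α ^ 2)⁻¹) ≠ 0 := by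
    rw [show a i * α * (a j * α) * (α ^ 2)⁻¹ = a i * a j by field_simp]
    exact qPochInf_ne_zero hq1 (ha i j hij)
  refine div_ne_zero (mul_ne_zero ?_ (mul_ne_zero (mul_ne_zero (mul_ne_zero ?_ ?_) ?_)
    (mul_ne_zero (mul_ne_zero ?_ ?_) ?_))) hz
  · rw [← mul_one (_ / q), base_eq a hα, mul_one]
    exact qPochInf_ne_zero hq1 hσ
  all_goals exact h _ _ (by decide)

lemma solution_casoratian {qh α : ℂ} {a : Fin 4 → ℂ} {rt : ℂ → ℂ}
    (hq0 : q ≠ 0) (hq1 : ‖q‖ < 1) (hqh : qh ^ 2 = q)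
    (hrtq : ∀ t : ℂ, t ≠ 0 → rt (q * t) = qh * rt t)
    (ha : ∀ j, a j ≠ 0) (hα : α ≠ 0) (hz : ‖q * (α ^ 2)⁻¹‖ < 1)
    (h : Nondegenerate q α a t) (hi : Nondegenerate q α a t⁻¹)
    (h1 : Nondegenerate q α a (q * t)) (h1i : Nondegenerate q α a (q * t)⁻¹) :
    solution q qh α a rt t * solution q qh α a rt (q * t)⁻¹ -
        solution q qh α a rt (q * t) * solution q qh α a rt t⁻¹ =
      prefactor q qh α rt t * prefactor q qh α rt (q * t)⁻¹ /
        (fourPochInf q (a 0 * α) (a 1 * α) (a 2 * α) (a 3 * α) t *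
          fourPochInf q (a 0 * α) (a 1 * α) (a 2 * α) (a 3 * α) (q * t)⁻¹) *
        casConst q (α ^ 2)⁻¹ (a 1 * α) (a 2 * α) (a 3 * α) (a 0 * α) := by
  have ht0 := h.ne_zero
  have ht := h.sq_notMem hq0
  have hu : q * (q * t)⁻¹ = t⁻¹ := by rw [mul_inv, mul_inv_cancel_left₀ hq0]
  have p1 := prefactor_mul hq0 hq1 hqh (hrtq t ht0) hα ht0 ht
  have p2 := prefactor_mul hq0 hq1 hqh (hrtq _ h1i.ne_zero) hα h1i.ne_zero (h1i.sq_notMem hq0)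
  have f1 := fourPochInf_eq (t := t) hq1 (a 0 * α) (a 1 * α) (a 2 * α) (a 3 * α)
  have f2 := fourPochInf_eq (t := (q * t)⁻¹) hq1 (a 0 * α) (a 1 * α) (a 2 * α) (a 3 * α)
  rw [hu] at p2 f2
  have n0 := fourPochInf_ne_zero hq1 h
  have nu := fourPochInf_ne_zero hq1 h1i
  have hc := nCas_eval hq0 hq1 (inv_ne_zero (pow_ne_zero 2 hα)) hz ht0 ht (a 1 * α) (a 0 * α)
    (mul_ne_zero (ha 2) hα) (mul_ne_zero (ha 3) hα) (base_ne_zero hq1 hα h)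
    (base_ne_zero hq1 hα h1i)
  rw [← hc, nCas, casFactor_eq hq0 ht0 ht]
  rw [solution_eq rt hq0 hq1 hα ha h, solution_eq rt hq0 hq1 hα ha h1,
    solution_eq rt hq0 hq1 hα ha hi, solution_eq rt hq0 hq1 hα ha h1i, p1, p2]
  simp only [solSum]
  rw [f1] at n0 ⊢
  rw [f2] at nu ⊢
  have := left_ne_zero_of_mul n0
  have := right_ne_zero_of_mul n0
  have := left_ne_zero_of_mul nu
  have := right_ne_zero_of_mul nu
  generalize fourFactor (a 0 * α) (a 1 * α) (a 2 * α) (a 3 * α) t = F at *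
  generalize fourFactor (a 0 * α) (a 1 * α) (a 2 * α) (a 3 * α) (q * t)⁻¹ = Fu at *
  generalize fourPochInf q (a 0 * α) (a 1 * α) (a 2 * α) (a 3 * α) (q * t) = P at *
  generalize fourPochInf q (a 0 * α) (a 1 * α) (a 2 * α) (a 3 * α) t⁻¹ = Pu at *
  generalize nSum q (α ^ 2)⁻¹ (a 1 * α) (a 2 * α) (a 3 * α) t (a 0 * α) = N₀
  generalize nSum q (α ^ 2)⁻¹ (a 1 * α) (a 2 * α) (a 3 * α) (q * t) (a 0 * α) = N₁
  generalize nSum q (α ^ 2)⁻¹ (a 1 * α) (a 2 * α) (a 3 * α) (q * t)⁻¹ (a 0 * α) = N₂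
  generalize nSum q (α ^ 2)⁻¹ (a 1 * α) (a 2 * α) (a 3 * α) t⁻¹ (a 0 * α) = N₃
  generalize prefactorRatio q (α ^ 2)⁻¹ t = r₁
  generalize prefactorRatio q (α ^ 2)⁻¹ (q * t)⁻¹ = r₂
  generalize prefactor q qh α rt t = φ
  generalize prefactor q qh α rt (q * t)⁻¹ = φu
  field_simp

lemma solution_casoratian_ne_zero {qh α : ℂ} {a : Fin 4 → ℂ} {rt : ℂ → ℂ}
    (hq0 : q ≠ 0) (hq1 : ‖q‖ < 1) (hqh : qh ^ 2 = q)
    (hrt : ∀ t : ℂ, t ≠ 0 → rt t ^ 2 = t) (hrtq : ∀ t : ℂ, t ≠ 0 → rt (q * t) = qh * rt t)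
    (ha : ∀ j, a j ≠ 0) (hα : α ≠ 0) (hz : ‖q * (α ^ 2)⁻¹‖ < 1)
    (hσ : q⁻¹ * sigma a 4 * α ^ 2 ∉ qNeg q) (haa : ∀ i j, i ≠ j → a i * a j ∉ qNeg q)
    (hp : PrefactorNeZero q qh α t)
    (h : Nondegenerate q α a t) (hi : Nondegenerate q α a t⁻¹)
    (h1 : Nondegenerate q α a (q * t)) (h1i : Nondegenerate q α a (q * t)⁻¹) :
    solution q qh α a rt t * solution q qh α a rt (q * t)⁻¹ -
        solution q qh α a rt (q * t) * solution q qh α a rt t⁻¹ ≠ 0 := by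
  obtain ⟨p1, p2, p3, p4⟩ := hp
  have ht0 := h.ne_zero
  have hu : q * (q * t)⁻¹ = t⁻¹ := by rw [mul_inv, mul_inv_cancel_left₀ hq0]
  -- The prefactor is needed at `(qt)⁻¹` but is known to be nonzero at `t⁻¹ = q(qt)⁻¹`; the ratio
  -- formula transfers this.
  have e := prefactor_mul hq0 hq1 hqh (hrtq _ h1i.ne_zero) hα h1i.ne_zero (h1i.sq_notMem hq0)
  have n := prefactor_ne_zero hq0 hq1 hqh (hrt _ hi.ne_zero) hi.ne_zero hi.inv_sq p3 p4
  rw [hu] at e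
  rw [e] at n
  rw [solution_casoratian hq0 hq1 hqh hrtq ha hα hz h hi h1 h1i]
  exact mul_ne_zero (div_ne_zero (mul_ne_zero
    (prefactor_ne_zero hq0 hq1 hqh (hrt t ht0) ht0 h.inv_sq p1 p2) (right_ne_zero_of_mul n))
    (mul_ne_zero (fourPochInf_ne_zero hq1 h) (fourPochInf_ne_zero hq1 h1i)))
    (casConst_ne_zero hq1 hα (qPochInf_ne_zero_of_norm_lt_one hq0 hq1 hz) hσ haa)

/-- Inversion of `t` interchanges the outer terms with a change of sign, fixes the bracket and
changes the sign of `t - t⁻¹`, so the whole equation changes sign. -/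
lemma ThreeTermAt.inv {qh α : ℂ} {a : Fin 4 → ℂ} {m : ℂ → ℂ}
    (h : ThreeTermAt q qh α a m t⁻¹) : ThreeTermAt q qh α a (fun s => m s⁻¹) t := by
  unfold ThreeTermAt at h ⊢
  simp only [mul_inv, inv_inv] at h ⊢
  linear_combination -h

/-! ### Second-order recurrences on a q-orbit and the basis of solutions. -/

/-- A sequence on `ℤ` satisfying a three-term recurrence with nonvanishing outer coefficients
vanishes if it vanishes at `0` and `1`. -/
lemma eq_zero_of_recurrence {P Q S f : ℤ → ℂ} (hP : ∀ n, P n ≠ 0) (hS : ∀ n, S n ≠ 0)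
    (hf : ∀ n, P n * f (n + 1) - Q n * f n + S n * f (n - 1) = 0) (h0 : f 0 = 0) (h1 : f 1 = 0)
    (n : ℤ) : f n = 0 := by
  have key (n : ℤ) : f n = 0 ∧ f (n + 1) = 0 := by
    induction n using Int.induction_on with
    | zero => exact ⟨h0, by simpa using h1⟩
    | succ n ih =>
      refine ⟨ih.2, ?_⟩
      have := hf (n + 1)
      rw [add_sub_cancel_right, ih.1, ih.2, mul_zero, mul_zero, sub_zero, add_zero] at this
      exact (mul_eq_zero.mp this).resolve_left (hP _)
    | pred n ih =>
      refine ⟨?_, by rw [sub_add_cancel]; exact ih.1⟩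
      have := hf (-n)
      rw [ih.1, ih.2, mul_zero, mul_zero, sub_zero, zero_add] at this
      exact (mul_eq_zero.mp this).resolve_left (hS _)
  exact (key n).1

/-- Two solutions of a three-term recurrence on `ℤ` with nonvanishing Casoratian form a basis. -/
lemma existsUnique_of_recurrence {P Q S f g₁ g₂ : ℤ → ℂ} (hP : ∀ n, P n ≠ 0) (hS : ∀ n, S n ≠ 0)
    (hf : ∀ n, P n * f (n + 1) - Q n * f n + S n * f (n - 1) = 0)
    (hg₁ : ∀ n, P n * g₁ (n + 1) - Q n * g₁ n + S n * g₁ (n - 1) = 0)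
    (hg₂ : ∀ n, P n * g₂ (n + 1) - Q n * g₂ n + S n * g₂ (n - 1) = 0)
    (hD : g₁ 0 * g₂ 1 - g₁ 1 * g₂ 0 ≠ 0) :
    ∃! c : ℂ × ℂ, ∀ n, f n = c.1 * g₁ n + c.2 * g₂ n := by
  set D := g₁ 0 * g₂ 1 - g₁ 1 * g₂ 0 with hDef
  refine ⟨((f 0 * g₂ 1 - f 1 * g₂ 0) / D, (g₁ 0 * f 1 - g₁ 1 * f 0) / D), fun n => ?_, ?_⟩
  · refine sub_eq_zero.mp (eq_zero_of_recurrence (Q := Q) (f := fun n => f n -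
      ((f 0 * g₂ 1 - f 1 * g₂ 0) / D * g₁ n + (g₁ 0 * f 1 - g₁ 1 * f 0) / D * g₂ n))
      hP hS (fun n => ?_) ?_ ?_ n)
    · linear_combination hf n - (f 0 * g₂ 1 - f 1 * g₂ 0) / D * hg₁ n -
        (g₁ 0 * f 1 - g₁ 1 * f 0) / D * hg₂ n
    · field_simp
      rw [hDef]
      ring
    · field_simp
      rw [hDef]
      ring
  · rintro ⟨c₁, c₂⟩ hc
    have h0 := hc 0
    have h1 := hc 1
    refine Prod.ext ?_ ?_
    · rw [eq_div_iff hD, hDef, h0, h1]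
      ring
    · rw [eq_div_iff hD, hDef, h0, h1]
      ring

lemma PrefactorNeZero.zpow_mul {qh α : ℂ} (hq0 : q ≠ 0) (h : PrefactorNeZero q qh α t) (n : ℤ) :
    PrefactorNeZero q qh α (q ^ n * t) := by
  have hn := zpow_ne_zero n hq0
  have key (k : ℤ) (x y : ℂ) (hx : x ∉ qAll q) (hy : y = q ^ k * x) : y ∉ qAll q := by
    rintro ⟨j, hj⟩
    refine hx ⟨j - k, ?_⟩
    have := zpow_ne_zero k hq0
    rw [zpow_sub₀ hq0, ← hj, hy]
    field_simp
  obtain ⟨h1, h2, h3, h4⟩ := h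
  refine ⟨key n _ _ h1 (by ring), key n _ _ h2 (by ring), key (-n) _ _ h3 ?_, key (-n) _ _ h4 ?_⟩
  all_goals
    rw [mul_inv, ← zpow_neg]
    ring

/-- The factors are `1 - a_jα(q⁻¹s)`, so the conditions on `a_jαt` at the shifted point suffice. It
is applied with `s` on the orbit and with `s` the inverse of an orbit point. -/
lemma w0_ne_zero {qh α : ℂ} {a : Fin 4 → ℂ} {s : ℂ} (hqh : qh ^ 2 = q)
    (h : Nondegenerate q α a (q⁻¹ * s)) : w0 qh a (qh⁻¹ * α * s) ≠ 0 := by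
  have h' (j : Fin 4) : 1 - a j * α * (q⁻¹ * s) ≠ 0 := fun h0 => h.upper j ⟨0, by
    rw [pow_zero, inv_one]; linear_combination -h0⟩
  rw [w0_eq α a s hqh]
  exact mul_ne_zero (mul_ne_zero (mul_ne_zero (h' 0) (h' 1)) (h' 2)) (h' 3)

lemma outer_ne_zero {qh s : ℂ} (hq0 : q ≠ 0) (hqh : qh ^ 2 = q) (hs0 : s ≠ 0)
    (hs : s ^ 2 ∉ qAll q) : qh⁻¹ * s - qh * s⁻¹ ≠ 0 ∧ qh * s - qh⁻¹ * s⁻¹ ≠ 0 := by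
  have hqh0 : qh ≠ 0 := by
    rintro rfl
    exact hq0 (by rw [← hqh]; ring)
  rw [show qh⁻¹ * s - qh * s⁻¹ = (s ^ 2 - q) * (qh * s)⁻¹ by rw [← hqh]; field_simp,
    show qh * s - qh⁻¹ * s⁻¹ = (q * s ^ 2 - 1) * (qh * s)⁻¹ by rw [← hqh]; field_simp]
  refine ⟨mul_ne_zero (fun h => hs ⟨1, ?_⟩) (inv_ne_zero (mul_ne_zero hqh0 hs0)),
    mul_ne_zero (fun h => hs ⟨-1, ?_⟩) (inv_ne_zero (mul_ne_zero hqh0 hs0))⟩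
  · rw [zpow_one]
    linear_combination h
  · rw [zpow_neg_one]
    exact eq_inv_of_mul_eq_one_right (by linear_combination h)

lemma solution_basis {qh α : ℂ} {a : Fin 4 → ℂ} {rt : ℂ → ℂ}
    (hq0 : q ≠ 0) (hq1 : ‖q‖ < 1) (hqh : qh ^ 2 = q)
    (hrt : ∀ t : ℂ, t ≠ 0 → rt t ^ 2 = t) (hrtq : ∀ t : ℂ, t ≠ 0 → rt (q * t) = qh * rt t)
    (ha : ∀ j, a j ≠ 0) (hα : α ≠ 0) (hz : ‖q * (α ^ 2)⁻¹‖ < 1)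
    (hσ : q⁻¹ * sigma a 4 * α ^ 2 ∉ qNeg q) (haa : ∀ i j, i ≠ j → a i * a j ∉ qNeg q)
    (hp : PrefactorNeZero q qh α t)
    (hn : ∀ n : ℤ, Nondegenerate q α a (q ^ n * t) ∧ Nondegenerate q α a (q ^ n * t)⁻¹)
    (m : ℂ → ℂ) (hm : ∀ n : ℤ, ThreeTermAt q qh α a m (q ^ n * t)) :
    ∃! c : ℂ × ℂ, ∀ n : ℤ, m (q ^ n * t) =
      c.1 * solution q qh α a rt (q ^ n * t) + c.2 * solution q qh α a rt (q ^ n * t)⁻¹ := by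
  have e1 (n : ℤ) : q * (q ^ n * t) = q ^ (n + 1) * t := by rw [zpow_add_one₀ hq0]; ring
  have e2 (n : ℤ) : q⁻¹ * (q ^ n * t) = q ^ (n - 1) * t := by rw [zpow_sub_one₀ hq0]; ring
  have hsol (n : ℤ) : ThreeTermAt q qh α a (solution q qh α a rt) (q ^ n * t) :=
    solution_threeTerm hq0 hq1 hqh hrtq ha hα hz (by rw [e1]; exact (hn _).1) (hn n).1
      (by rw [e2]; exact (hn _).1)
  have hsol' (n : ℤ) : ThreeTermAt q qh α a (fun s => solution q qh α a rt s⁻¹) (q ^ n * t) := by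
    refine ThreeTermAt.inv (solution_threeTerm hq0 hq1 hqh hrtq ha hα hz ?_ (hn n).2 ?_)
    · rw [show q * (q ^ n * t)⁻¹ = (q⁻¹ * (q ^ n * t))⁻¹ by rw [mul_inv q⁻¹, inv_inv], e2]
      exact (hn _).2
    · rw [← mul_inv, e1]
      exact (hn _).2
  have hd := solution_casoratian_ne_zero hq0 hq1 hqh hrt hrtq ha hα hz hσ haa hp
    (by simpa using (hn 0).1) (by simpa using (hn 0).2) (by simpa using (hn 1).1)
    (by simpa using (hn 1).2)
  have hs (n : ℤ) : (q ^ n * t) ^ 2 ∉ qAll q := (hn n).1.sq_notMem hq0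
  simp only [ThreeTermAt, e1, e2] at hm hsol hsol'
  refine existsUnique_of_recurrence (f := fun n => m (q ^ n * t))
    (g₁ := fun n => solution q qh α a rt (q ^ n * t))
    (g₂ := fun n => solution q qh α a rt (q ^ n * t)⁻¹) (fun n => mul_ne_zero ?_ (w0_ne_zero hqh ?_))
    (fun n => mul_ne_zero ?_ (w0_ne_zero hqh ?_)) hm hsol hsol' ?_
  · exact (outer_ne_zero hq0 hqh (hn n).1.ne_zero (hs n)).1
  · rw [← mul_inv, e1]
    exact (hn _).2
  · exact (outer_ne_zero hq0 hqh (hn n).1.ne_zero (hs n)).2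
  · rw [e2]
    exact (hn _).1
  · simpa using hd

end QMoment

theorem mainTheorem8 (q qh α : ℂ) (a : Fin 4 → ℂ) (rt : ℂ → ℂ)
    (hq0 : q ≠ 0) (hq1 : ‖q‖ < 1) (hqh : qh ^ 2 = q)
    (hrt : ∀ t : ℂ, t ≠ 0 → rt t ^ 2 = t)
    (hrtq : ∀ t : ℂ, t ≠ 0 → rt (q * t) = qh * rt t)
    (ha : ∀ j, a j ≠ 0)
    (hα : ‖q‖ < ‖α ^ 2‖)
    (hσ : q⁻¹ * QMoment.sigma a 4 * α ^ 2 ∉ QMoment.qNeg q) :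
    -- the function is a solution of the recurrence
    (∀ t : ℂ, QMoment.Nondegenerate q α a (q * t) → QMoment.Nondegenerate q α a t →
      QMoment.Nondegenerate q α a (q⁻¹ * t) →
      QMoment.ThreeTermAt q qh α a (QMoment.solution q qh α a rt) t) ∧
    -- so is the function with `t` replaced by `t⁻¹`
    (∀ t : ℂ, QMoment.Nondegenerate q α a (q * t)⁻¹ → QMoment.Nondegenerate q α a t⁻¹ →
      QMoment.Nondegenerate q α a (q⁻¹ * t)⁻¹ →
      QMoment.ThreeTermAt q qh α a (fun s => QMoment.solution q qh α a rt s⁻¹) t) ∧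
    -- the two solutions are independent: their Casoratian does not vanish
    ((∀ i j, i ≠ j → a i * a j ∉ QMoment.qNeg q) →
      ∀ t : ℂ, QMoment.PrefactorNeZero q qh α t →
        QMoment.Nondegenerate q α a t → QMoment.Nondegenerate q α a t⁻¹ →
        QMoment.Nondegenerate q α a (q * t) → QMoment.Nondegenerate q α a (q * t)⁻¹ →
        QMoment.solution q qh α a rt t * QMoment.solution q qh α a rt (q * t)⁻¹
          - QMoment.solution q qh α a rt (q * t) * QMoment.solution q qh α a rt t⁻¹ ≠ 0) ∧
    -- along each generic orbit they form a basis of the space of solutions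
    ((∀ i j, i ≠ j → a i * a j ∉ QMoment.qNeg q) →
      ∀ t : ℂ, QMoment.PrefactorNeZero q qh α t →
        (∀ n : ℤ, QMoment.Nondegenerate q α a (q ^ n * t) ∧
          QMoment.Nondegenerate q α a (q ^ n * t)⁻¹) →
        ∀ m : ℂ → ℂ, (∀ n : ℤ, QMoment.ThreeTermAt q qh α a m (q ^ n * t)) →
          ∃! c : ℂ × ℂ, ∀ n : ℤ, m (q ^ n * t) =
            c.1 * QMoment.solution q qh α a rt (q ^ n * t)
              + c.2 * QMoment.solution q qh α a rt (q ^ n * t)⁻¹) := by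
  have hαn : 0 < ‖α ^ 2‖ := (norm_nonneg q).trans_lt hα
  have hα0 : α ≠ 0 := by
    rintro rfl
    simp at hαn
  have hz : ‖q * (α ^ 2)⁻¹‖ < 1 := by
    rw [norm_mul, norm_inv, ← div_eq_mul_inv]
    exact (div_lt_one hαn).mpr hα
  refine ⟨fun t h1 h0 hm => ?_, fun t h1 h0 hm => ?_, fun haa t hp h hi h1 h1i => ?_,
    fun haa t hp hn m hm => ?_⟩
  · exact QMoment.solution_threeTerm hq0 hq1 hqh hrtq ha hα0 hz h1 h0 hm
  · refine QMoment.ThreeTermAt.inv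
      (QMoment.solution_threeTerm hq0 hq1 hqh hrtq ha hα0 hz ?_ h0 ?_)
    · rwa [mul_inv, inv_inv] at hm
    · rwa [mul_inv] at h1
  · exact QMoment.solution_casoratian_ne_zero hq0 hq1 hqh hrt hrtq ha hα0 hz hσ haa hp h hi h1 h1i
  · exact QMoment.solution_basis hq0 hq1 hqh hrt hrtq ha hα0 hz hσ haa hp hn m hm
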